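/- Let $G,c_1,a_0,m\in\mathbb R$, $\Sigma_0>0$ and $R_d>0$. Consider the infinitely thin exponential disk, i.e. the mass distribution $\rho$ on $\mathbb R^3$ carried by the plane $z=0$ with surface density $\Sigma(R)=\Sigma_0e^{-R/R_d}$, where $R$ is the distance to the origin in that plane (so $d\rho=\Sigma(R)\,\delta(z)\,d^3x$). Let $M$ be its total mass, let $$\Phi(x)=-G\int\frac{d\rho(x')}{|x'-x|}+\frac{2c_1a_0}{M}\int|x'-x|\,d\rho(x')$$ be its potential, and let $$F^{a_0}(x)=m\,\frac{2c_1a_0}{M}\int\frac{x'-x}{|x'-x|}\,d\rho(x')$$ be the $a_0$-dependent part of the force on a particle of mass $m$ at $x$. Then all these integrals converge for every $x\in\mathbb R^3$, and $M=2\pi\Sigma_0R_d^2$. Moreover, for every radius $r>0$ and every azimuth $\varphi$, with $y=r/(2R_d)$ and $e_r=(\cos\varphi,\sin\varphi,0)$, the potential is differentiable in the radial direction at the point $re_r$ of the disk plane, and the circular velocity $v$ there, given by $v^2=r\,\partial\Phi/\partial r$, satisfies $$v^2(r)=4\pi G\Sigma_0R_d\,y^2\,[I_0(y)K_0(y)-I_1(y)K_1(y)]+8c_1a_0R_d\,y^2\,I_1(y)K_1(y),$$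 where $I_n,K_n$ are the modified Bessel functions of the first and second kind. The $a_0$-part of the force points toward the center with (signed) magnitude $4c_1ma_0\,y\,I_1(y)K_1(y)$: $$F^{a_0}(re_r)=-4c_1ma_0\,y\,I_1(y)K_1(y)\,e_r.$$ -/

import Mathlib

open MeasureTheory

noncomputable section

namespace ExpDisk

/-- The modified Bessel function of the first kind of integer order `n`,
`I_n(z) = ∑_k (z/2)^(2k+n) / (k! (k+n)!)`. -/
def besselI (n : ℕ) (z : ℝ) : ℝ :=
  ∑' k : ℕ, (z / 2) ^ (2 * k + n) / ((k.factorial : ℝ) * ((k + n).factorial : ℝ))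

/-- The modified Bessel function of the second kind of integer order `n`, for `z > 0`,
`K_n(z) = ∫_0^∞ exp(-z cosh t) cosh(n t) dt`. -/
def besselK (n : ℕ) (z : ℝ) : ℝ :=
  ∫ t in Set.Ioi (0 : ℝ), Real.exp (-z * Real.cosh t) * Real.cosh (n * t)

/-- Euclidean space of dimension three, with Cartesian coordinates `(x, y, z)`. -/
abbrev Space : Type := EuclideanSpace ℝ (Fin 3)

/-- The inclusion of the plane `z = 0` into space. -/
def planeEmbedding (p : EuclideanSpace ℝ (Fin 2)) : Space := !₂[p 0, p 1, 0]

/-- The inclusion is measurable, so that the push-forward below is the intended one. -/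
theorem measurable_planeEmbedding : Measurable planeEmbedding := by
  have h : Continuous planeEmbedding := by
    refine (PiLp.continuous_toLp 2 _).comp (continuous_pi fun i => ?_)
    fin_cases i <;> simp <;> fun_prop
  exact h.measurable

/-- The mass distribution `S₀ exp(-R/R_d) δ(z)` of the infinitely thin exponential disk: the
measure on space carried by the plane `z = 0`, with surface density `S₀ exp(-R/R_d)` there. -/
def disk (S₀ Rd : ℝ) : Measure Space :=
  ((volume : Measure (EuclideanSpace ℝ (Fin 2))).withDensity
    fun p => ENNReal.ofReal (S₀ * Real.exp (-‖p‖ / Rd))).map planeEmbedding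

/-- The total mass of a mass distribution. -/
def totalMass (ρ : Measure Space) : ℝ := ρ.real Set.univ

/-- The potential `-G ∫ ρ(x') d³x' / |x' - x| + (2 c₁ a₀ / M) ∫ ρ(x') |x' - x| d³x'`. -/
def potential (G c₁ a₀ : ℝ) (ρ : Measure Space) (x : Space) : ℝ :=
  -G * (∫ x', 1 / ‖x' - x‖ ∂ρ) + 2 * c₁ * a₀ / totalMass ρ * ∫ x', ‖x' - x‖ ∂ρ

/-- The `a₀`-dependent part of the force on a particle of mass `m` at `x`,
`m (2 c₁ a₀ / M) ∫ (x' - x) / |x' - x| ρ(x') d³x'`. -/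
def accelForce (c₁ a₀ m : ℝ) (ρ : Measure Space) (x : Space) : Space :=
  (m * (2 * c₁ * a₀ / totalMass ρ)) • ∫ x', (1 / ‖x' - x‖) • (x' - x) ∂ρ

/-- The horizontal radial unit vector at azimuth `φ`. -/
def radialDir (φ : ℝ) : Space := !₂[Real.cos φ, Real.sin φ, 0]

/-- The radial profile of a potential in the plane `z = 0` at azimuth `φ`. -/
def radialProfile (Φ : Space → ℝ) (φ : ℝ) (s : ℝ) : ℝ := Φ (s • radialDir φ)

/-- The square `v² = r ∂Φ/∂r` of the circular velocity in the plane `z = 0`, at radius `r` and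
azimuth `φ`. -/
def circularVelocitySq (Φ : Space → ℝ) (φ r : ℝ) : ℝ := r * deriv (radialProfile Φ φ) r

end ExpDisk

end

open MeasureTheory

noncomputable section

namespace ExpDisk

open Real Set Filter Topology

/-! Use polar coordinates (s, θ) centred at the field point r e_r. The Jacobian s cancels the factor
1/|x' - x|, and gluing opposite directions leaves integrals over full lines through that point, θ ∈
(0, π). The line at angle θ passes the disk centre at distance b = r sin θ, and u = b sinh t gives ∫
exp(-√(u² + b²)/d) du = 2b K₁(b/d). With y = r/(2 R_d) and w = 2y sin θ, the Newtonian integral is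
therefore 2π S₀ R_d E, where E (`meanKOne`) is the mean of w K₁(w). First moments along the lines
express the unit-vector integral through the mean B (`meanCosSqKOne`) of cos² θ w K₁(w).

The Newtonian part of v² needs E' = -2L, with L (`meanSinKZero`) the mean of sin θ w K₀(w). The
integral of |x' - x| is never evaluated: its radial derivative is minus the radial component of the
unit-vector integral.

It remains to show B = I₁K₁ and L = y(I₀K₀ - I₁K₁). The triple (E, B, L) satisfies a closed linear
system. Put P = yB, Q = yB + L and q(a, b) = P a² + E ab - Q b². Both (I₀, -I₁) and (K₀, K₁) solve
a' = -b, b' = -a - b/y, and along solutions of this system y·q and its polar form are constant.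
Limits at 0 or ∞ give the three constants (`invariant_besselI_besselI`, `invariant_besselK_besselK`,
`invariant_besselI_besselK`); the Wronskian makes the two vectors a basis, which determines q
(`mul_meanCosSqKOne_and_add`). -/

/-! ### The integrals defining K₀ and K₁: derivatives and bounds. -/

lemma inv_cosh_le (t : ℝ) : (cosh t)⁻¹ ≤ 2 * exp (-t) := by
  rw [inv_le_iff_one_le_mul₀ (cosh_pos t), cosh_eq]
  have h : exp (-t) * exp t = 1 := by rw [← exp_add]; simp
  nlinarith [sq_nonneg (exp (-t))]

/-- The exponential series bounds one more power of cosh than needed; the spare factor 1/cosh t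
supplies an integrable tail. -/
lemma exp_neg_mul_cosh_mul_pow_le (n : ℕ) {w : ℝ} (hw : 0 < w) (t : ℝ) :
    exp (-w * cosh t) * cosh t ^ n ≤ (n + 1).factorial / w ^ (n + 1) * (2 * exp (-t)) := by
  have hc := cosh_pos t
  have h1 := pow_div_factorial_le_exp (w * cosh t) (by positivity) (n + 1)
  have h2 : exp (-w * cosh t) * cosh t ^ (n + 1) ≤ (n + 1).factorial / w ^ (n + 1) := by
    rw [neg_mul, exp_neg, le_div_iff₀ (by positivity), inv_mul_eq_div, div_mul_eq_mul_div,
      div_le_iff₀ (exp_pos _)]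
    rw [div_le_iff₀ (by positivity), mul_pow] at h1
    nlinarith
  calc exp (-w * cosh t) * cosh t ^ n
      = exp (-w * cosh t) * cosh t ^ (n + 1) * (cosh t)⁻¹ := by
        rw [pow_succ]; field_simp
    _ ≤ _ := mul_le_mul h2 (inv_cosh_le t) (by positivity) (by positivity)

lemma integrableOn_exp_neg_mul_cosh_mul_pow (n : ℕ) {w : ℝ} (hw : 0 < w) :
    IntegrableOn (fun t => exp (-w * cosh t) * cosh t ^ n) (Ioi 0) := by
  have h : IntegrableOn (fun t : ℝ => (n + 1).factorial / w ^ (n + 1) * (2 * exp (-t)))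
      (Ioi 0) := ((integrableOn_exp_neg_Ioi 0).const_mul 2).const_mul _
  refine h.mono' ?_ (ae_of_all _ fun t => ?_)
  · exact Continuous.aestronglyMeasurable (by fun_prop)
  · rw [norm_of_nonneg (by have := cosh_pos t; positivity)]
    exact exp_neg_mul_cosh_mul_pow_le n hw t

/-- The integrals `∫_0^∞ exp(-w cosh t) cosh(t)^n dt`. -/
def coshMoment (n : ℕ) (w : ℝ) : ℝ := ∫ t in Ioi (0 : ℝ), exp (-w * cosh t) * cosh t ^ n

lemma besselK_zero_eq (w : ℝ) : besselK 0 w = coshMoment 0 w := by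
  simp [besselK, coshMoment]

lemma besselK_one_eq (w : ℝ) : besselK 1 w = coshMoment 1 w := by
  simp [besselK, coshMoment]

lemma hasDerivAt_coshMoment (n : ℕ) {w : ℝ} (hw : 0 < w) :
    HasDerivAt (coshMoment n) (-coshMoment (n + 1) w) w := by
  have hs : Ioi (w / 2) ∈ 𝓝 w := Ioi_mem_nhds (by linarith)
  have := (hasDerivAt_integral_of_dominated_loc_of_deriv_le (μ := volume.restrict (Ioi (0 : ℝ)))
    (F := fun x t => exp (-x * cosh t) * cosh t ^ n)
    (F' := fun x t => -(exp (-x * cosh t) * cosh t ^ (n + 1)))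
    (bound := fun t => exp (-(w / 2) * cosh t) * cosh t ^ (n + 1)) hs
    (Eventually.of_forall fun x => Continuous.aestronglyMeasurable (by fun_prop))
    (integrableOn_exp_neg_mul_cosh_mul_pow n hw)
    (Continuous.aestronglyMeasurable (by fun_prop))
    (ae_of_all _ fun t x hx => ?_)
    (integrableOn_exp_neg_mul_cosh_mul_pow (n + 1) (by positivity))
    (ae_of_all _ fun t x hx => ?_)).2
  · rw [integral_neg] at this
    exact this
  · have hc := cosh_pos t
    rw [norm_neg, norm_of_nonneg (by positivity)]
    have : w / 2 ≤ x := le_of_lt hx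
    gcongr
  · have h1 : HasDerivAt (fun x : ℝ => -x * cosh t) (-cosh t) x := by
      simpa using (hasDerivAt_id x).neg.mul_const (cosh t)
    convert! h1.exp.mul_const (cosh t ^ n) using 1
    ring

lemma tendsto_exp_neg_mul_cosh_mul_pow (n : ℕ) {w : ℝ} (hw : 0 < w) :
    Tendsto (fun t => exp (-w * cosh t) * cosh t ^ n) atTop (𝓝 0) := by
  refine squeeze_zero (fun t => by have := cosh_pos t; positivity)
    (exp_neg_mul_cosh_mul_pow_le n hw) ?_
  have := ((tendsto_exp_neg_atTop_nhds_zero).const_mul 2).const_mul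
    ((n + 1).factorial / w ^ (n + 1) : ℝ)
  simpa using this

lemma integral_exp_neg_mul_cosh_mul_sinh {w : ℝ} (hw : 0 < w) :
    IntegrableOn (fun t => exp (-w * cosh t) * sinh t) (Ioi 0) ∧
      ∫ t in Ioi (0 : ℝ), exp (-w * cosh t) * sinh t = exp (-w) / w := by
  have hi : IntegrableOn (fun t => exp (-w * cosh t) * sinh t) (Ioi 0) := by
    refine (integrableOn_exp_neg_mul_cosh_mul_pow 1 hw).mono'
      (Continuous.aestronglyMeasurable (by fun_prop)) ?_
    refine (ae_restrict_iff' measurableSet_Ioi).2 (ae_of_all _ fun t (ht : 0 < t) => ?_)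
    rw [norm_of_nonneg (mul_nonneg (exp_pos _).le (sinh_nonneg_iff.2 ht.le)), pow_one]
    gcongr
    exact (sinh_lt_cosh t).le
  refine ⟨hi, ?_⟩
  have h := integral_Ioi_of_hasDerivAt_of_tendsto' (a := 0) (m := 0)
    (f := fun t => -(1 / w) * exp (-w * cosh t)) (f' := fun t => exp (-w * cosh t) * sinh t)
    (fun t _ => ?_) hi ?_
  · rw [h]; simp; ring
  · have := (((hasDerivAt_cosh t).const_mul (-w)).exp).const_mul (-(1 / w))
    convert! this using 1
    field_simp
  · simpa using (tendsto_exp_neg_mul_cosh_mul_pow 0 hw).const_mul (-(1 / w))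

/-- Integrate the derivative of exp(-w cosh t) sinh t, which vanishes at 0 and at ∞. This recurrence
closes the system for K₀, K₁. -/
lemma coshMoment_two {w : ℝ} (hw : 0 < w) :
    coshMoment 2 w = coshMoment 0 w + coshMoment 1 w / w := by
  have h0 := integrableOn_exp_neg_mul_cosh_mul_pow 0 hw
  have h1 := integrableOn_exp_neg_mul_cosh_mul_pow 1 hw
  have h2 := integrableOn_exp_neg_mul_cosh_mul_pow 2 hw
  have h := integral_Ioi_of_hasDerivAt_of_tendsto' (a := 0) (m := 0)
    (f := fun t => exp (-w * cosh t) * sinh t)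
    (f' := fun t => exp (-w * cosh t) * cosh t ^ 1 + w * (exp (-w * cosh t) * cosh t ^ 0)
      - w * (exp (-w * cosh t) * cosh t ^ 2))
    (fun t _ => ?_) ((h1.add (h0.const_mul w)).sub (h2.const_mul w)) ?_
  · rw [integral_sub, integral_add, integral_const_mul, integral_const_mul] at h
    · change coshMoment 1 w + w * coshMoment 0 w - w * coshMoment 2 w = _ at h
      simp at h
      field_simp
      linarith
    · exact h1
    · exact h0.const_mul w
    · exact h1.add (h0.const_mul w)
    · exact h2.const_mul w
  · have := (((hasDerivAt_cosh t).const_mul (-w)).exp).mul (hasDerivAt_sinh t)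
    convert! this using 1
    linear_combination (-w * exp (-w * cosh t)) * cosh_sq t
  · have h3 := tendsto_exp_neg_mul_cosh_mul_pow 1 hw
    refine squeeze_zero_norm (fun t => ?_) h3
    rw [norm_mul, norm_of_nonneg (exp_pos _).le, pow_one]
    gcongr
    rw [norm_eq_abs, abs_sinh, ← cosh_abs]
    exact (sinh_lt_cosh _).le

lemma hasDerivAt_besselK_zero {w : ℝ} (hw : 0 < w) :
    HasDerivAt (besselK 0) (-besselK 1 w) w := by
  rw [besselK_one_eq, show besselK 0 = coshMoment 0 from funext besselK_zero_eq]
  exact hasDerivAt_coshMoment 0 hw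

lemma hasDerivAt_besselK_one {w : ℝ} (hw : 0 < w) :
    HasDerivAt (besselK 1) (-besselK 0 w - besselK 1 w / w) w := by
  have := hasDerivAt_coshMoment 1 hw
  rw [coshMoment_two hw] at this
  rw [besselK_one_eq, besselK_zero_eq, show besselK 1 = coshMoment 1 from funext besselK_one_eq]
  convert! this using 1
  ring

lemma besselK_zero_nonneg (w : ℝ) : 0 ≤ besselK 0 w := by
  rw [besselK_zero_eq]
  exact integral_nonneg fun t => by have := cosh_pos t; simp only [Pi.zero_apply]; positivity

lemma besselK_zero_le_one {w : ℝ} (hw : 0 < w) : besselK 0 w ≤ besselK 1 w := by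
  rw [besselK_zero_eq, besselK_one_eq]
  refine integral_mono (integrableOn_exp_neg_mul_cosh_mul_pow 0 hw)
    (integrableOn_exp_neg_mul_cosh_mul_pow 1 hw) fun t => ?_
  have := one_le_cosh t
  simp only [pow_zero, pow_one]
  gcongr

/-- Split cosh t = sinh t + exp(-t): the sinh part integrates exactly to exp(-w)/w, and the rest
lies between 0 and exp(-w). The bounds control w K₁(w) both at the origin and at infinity. -/
lemma mul_besselK_one_bounds {w : ℝ} (hw : 0 < w) :
    exp (-w) ≤ w * besselK 1 w ∧ w * besselK 1 w ≤ exp (-w) * (1 + w) := by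
  obtain ⟨hi, hs⟩ := integral_exp_neg_mul_cosh_mul_sinh hw
  have h1 := integrableOn_exp_neg_mul_cosh_mul_pow 1 hw
  have hsub : (∫ t in Ioi (0 : ℝ), exp (-w * cosh t) * exp (-t)) = besselK 1 w - exp (-w) / w := by
    rw [besselK_one_eq, ← hs, coshMoment, ← integral_sub h1 hi]
    congr 1 with t
    rw [← cosh_sub_sinh]; ring
  have hn : 0 ≤ ∫ t in Ioi (0 : ℝ), exp (-w * cosh t) * exp (-t) :=
    integral_nonneg fun t => by simp only [Pi.zero_apply]; positivity
  have hle : (∫ t in Ioi (0 : ℝ), exp (-w * cosh t) * exp (-t)) ≤ exp (-w) := by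
    have h2 : ∫ t in Ioi (0 : ℝ), exp (-w) * exp (-t) = exp (-w) := by
      rw [integral_const_mul, integral_exp_neg_Ioi]; simp
    rw [← h2]
    refine integral_mono_of_nonneg (ae_of_all _ fun t => by simp only [Pi.zero_apply]; positivity)
      ((integrableOn_exp_neg_Ioi 0).const_mul _) (ae_of_all _ fun t => ?_)
    have := one_le_cosh t
    simp only
    gcongr
    nlinarith
  rw [hsub] at hn hle
  have e : w * (besselK 1 w - exp (-w) / w) = w * besselK 1 w - exp (-w) := by field_simp
  constructor
  · nlinarith
  · nlinarith

/-! ### The functions w K₁(w) and w K₀(w) on the closed half-line. -/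

/-- The function `w K_1(w)`, continued by its limit `1` at the origin. -/
def mulBesselKOne (w : ℝ) : ℝ := if w = 0 then 1 else w * besselK 1 w

/-- The function `w K_0(w)`, which vanishes at the origin. -/
def mulBesselKZero (w : ℝ) : ℝ := w * besselK 0 w

lemma mulBesselKOne_of_pos {w : ℝ} (hw : 0 < w) : mulBesselKOne w = w * besselK 1 w :=
  if_neg hw.ne'

@[simp] lemma mulBesselKOne_zero : mulBesselKOne 0 = 1 := if_pos rfl

lemma exp_neg_le_mulBesselKOne {w : ℝ} (hw : 0 ≤ w) : exp (-w) ≤ mulBesselKOne w := by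
  rcases hw.eq_or_lt with rfl | h
  · simp
  · rw [mulBesselKOne_of_pos h]; exact (mul_besselK_one_bounds h).1

lemma mulBesselKOne_le_exp_mul {w : ℝ} (hw : 0 ≤ w) :
    mulBesselKOne w ≤ exp (-w) * (1 + w) := by
  rcases hw.eq_or_lt with rfl | h
  · simp
  · rw [mulBesselKOne_of_pos h]; exact (mul_besselK_one_bounds h).2

lemma mulBesselKOne_nonneg {w : ℝ} (hw : 0 ≤ w) : 0 ≤ mulBesselKOne w :=
  (exp_pos _).le.trans (exp_neg_le_mulBesselKOne hw)

lemma mulBesselKOne_le_one {w : ℝ} (hw : 0 ≤ w) : mulBesselKOne w ≤ 1 := by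
  refine (mulBesselKOne_le_exp_mul hw).trans ?_
  rw [exp_neg, inv_mul_le_iff₀ (exp_pos _)]
  linarith [add_one_le_exp w]

lemma mulBesselKZero_nonneg {w : ℝ} (hw : 0 ≤ w) : 0 ≤ mulBesselKZero w :=
  mul_nonneg hw (besselK_zero_nonneg w)

lemma mulBesselKZero_le {w : ℝ} (hw : 0 ≤ w) : mulBesselKZero w ≤ mulBesselKOne w := by
  rcases hw.eq_or_lt with rfl | h
  · simp [mulBesselKZero]
  · rw [mulBesselKOne_of_pos h]
    exact mul_le_mul_of_nonneg_left (besselK_zero_le_one h) hw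

lemma hasDerivAt_mulBesselKOne {w : ℝ} (hw : 0 < w) :
    HasDerivAt mulBesselKOne (-mulBesselKZero w) w := by
  have h : HasDerivAt (fun w => w * besselK 1 w) (-mulBesselKZero w) w := by
    convert! (hasDerivAt_id w).mul (hasDerivAt_besselK_one hw) using 1
    simp only [mulBesselKZero, id]
    field_simp
    ring
  refine h.congr_of_eventuallyEq ?_
  filter_upwards [Ioi_mem_nhds hw] with x hx using mulBesselKOne_of_pos hx

lemma hasDerivAt_mulBesselKZero {w : ℝ} (hw : 0 < w) :
    HasDerivAt mulBesselKZero (mulBesselKZero w / w - mulBesselKOne w) w := by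
  convert! (hasDerivAt_id w).mul (hasDerivAt_besselK_zero hw) using 1
  simp only [mulBesselKZero, mulBesselKOne_of_pos hw, id]
  field_simp
  ring

lemma continuousOn_mulBesselKOne : ContinuousOn mulBesselKOne (Ici 0) := by
  intro w hw
  rcases (mem_Ici.1 hw).eq_or_lt with rfl | h
  · have hl : Tendsto (fun w : ℝ => exp (-w)) (𝓝[Ici 0] 0) (𝓝 1) := by
      have : ContinuousAt (fun w : ℝ => exp (-w)) 0 := by fun_prop
      simpa using this.tendsto.mono_left nhdsWithin_le_nhds
    have hu : Tendsto (fun w : ℝ => exp (-w) * (1 + w)) (𝓝[Ici 0] 0) (𝓝 1) := by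
      have : ContinuousAt (fun w : ℝ => exp (-w) * (1 + w)) 0 := by fun_prop
      simpa using this.tendsto.mono_left nhdsWithin_le_nhds
    rw [ContinuousWithinAt, mulBesselKOne_zero]
    refine tendsto_of_tendsto_of_tendsto_of_le_of_le' hl hu ?_ ?_
    · filter_upwards [self_mem_nhdsWithin] with x hx using exp_neg_le_mulBesselKOne hx
    · filter_upwards [self_mem_nhdsWithin] with x hx using mulBesselKOne_le_exp_mul hx
  · exact (hasDerivAt_mulBesselKOne h).continuousAt.continuousWithinAt

lemma tendsto_mulBesselKZero_zero : Tendsto mulBesselKZero (𝓝[Ici 0] 0) (𝓝 0) := by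
  have h := tendsto_integral_filter_of_dominated_convergence (l := 𝓝[Ici (0 : ℝ)] 0)
    (μ := volume.restrict (Ioi (0 : ℝ))) (F := fun w t => w * (exp (-w * cosh t) * cosh t ^ 0))
    (f := fun _ => 0) (fun t => 2 * exp (-t))
    (Eventually.of_forall fun x => Continuous.aestronglyMeasurable (by fun_prop)) ?_
    ((integrableOn_exp_neg_Ioi 0).const_mul 2) ?_
  · have e : mulBesselKZero = fun w => w * coshMoment 0 w :=
      funext fun w => by rw [mulBesselKZero, besselK_zero_eq]
    rw [e]
    simp only [integral_const_mul, integral_zero] at h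
    exact h
  · filter_upwards [self_mem_nhdsWithin] with w hw
    refine ae_of_all _ fun t => ?_
    have hw : 0 ≤ w := hw
    have hc := cosh_pos t
    rw [norm_of_nonneg (by positivity), pow_zero, mul_one]
    -- Since x exp(-x) ≤ 1 at x = w cosh t, the integrand is at most 1/cosh t, uniformly in w.
    refine le_trans ?_ (inv_cosh_le t)
    rw [← one_div, le_div_iff₀ hc, neg_mul, exp_neg, mul_right_comm, ← div_eq_mul_inv,
      div_le_one (exp_pos _)]
    linarith [add_one_le_exp (w * cosh t)]
  · refine ae_of_all _ fun t => ?_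
    have : ContinuousAt (fun w : ℝ => w * (exp (-w * cosh t) * cosh t ^ 0)) 0 := by fun_prop
    simpa using this.tendsto.mono_left nhdsWithin_le_nhds

lemma continuousOn_mulBesselKZero : ContinuousOn mulBesselKZero (Ici 0) := by
  intro w hw
  rcases (mem_Ici.1 hw).eq_or_lt with rfl | h
  · rw [ContinuousWithinAt, show mulBesselKZero 0 = 0 by simp [mulBesselKZero]]
    exact tendsto_mulBesselKZero_zero
  · exact (hasDerivAt_mulBesselKZero h).continuousAt.continuousWithinAt

/-! ### Power series and the derivatives of I₀ and I₁. -/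

lemma summable_of_abs_le_inv_factorial {c : ℕ → ℝ} (hc : ∀ k, |c k| ≤ 1 / k.factorial) (x : ℝ) :
    Summable fun k => c k * x ^ k := by
  refine .of_norm_bounded (g := fun k : ℕ => |x| ^ k / k.factorial)
    (summable_pow_div_factorial |x|) fun k => ?_
  rw [norm_mul, norm_pow, norm_eq_abs, norm_eq_abs, div_eq_mul_one_div, mul_comm]
  gcongr
  exact hc k

lemma hasDerivAt_tsum_mul_pow {c : ℕ → ℝ} (hc : ∀ k, |c k| ≤ 1 / k.factorial) (x : ℝ) :
    HasDerivAt (fun x => ∑' k, c k * x ^ k) (∑' k : ℕ, c (k + 1) * (k + 1) * x ^ k) x := by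
  have hu : Summable fun k : ℕ => k * (|x| + 1) ^ (k - 1) / k.factorial := by
    rw [← summable_nat_add_iff 1]
    refine (summable_pow_div_factorial (|x| + 1)).congr fun k => ?_
    rw [Nat.factorial_succ, Nat.add_sub_cancel]
    push_cast
    field_simp
  have hb : ∀ (k : ℕ) (y : ℝ), |y| ≤ |x| + 1 →
      ‖c k * (k * y ^ (k - 1))‖ ≤ k * (|x| + 1) ^ (k - 1) / k.factorial := fun k y hy => by
    rw [norm_mul, norm_mul, norm_pow, norm_eq_abs, norm_eq_abs, Nat.abs_cast,
      div_eq_mul_one_div, mul_comm]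
    gcongr
    · exact hy
    · exact hc k
  have h := hasDerivAt_tsum_of_isPreconnected (𝕜 := ℝ) (F := ℝ)
    (g := fun k x => c k * x ^ k) (g' := fun k x => c k * (k * x ^ (k - 1)))
    (t := Metric.ball 0 (|x| + 1)) hu Metric.isOpen_ball (convex_ball _ _).isPreconnected
    (fun k y _ => (hasDerivAt_pow k y).const_mul (c k))
    (fun k y hy => hb k y (by simpa using (mem_ball_zero_iff.1 hy).le))
    (y₀ := x) (y := x) (by simp) (summable_of_abs_le_inv_factorial hc x) (by simp)
  convert! h using 1
  have hs : Summable fun k : ℕ => c k * (k * x ^ (k - 1)) :=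
    .of_norm_bounded hu fun k => hb k x (by linarith)
  rw [hs.tsum_eq_zero_add]
  simp only [Nat.cast_zero, zero_mul, mul_zero, zero_add, Nat.add_sub_cancel]
  congr 1 with k
  push_cast
  ring

/-- The series `∑ x^k / (k! (k+n)!)`, in terms of which `I_n(z) = (z/2)^n F_n(z²/4)`. -/
def besselSeries (n : ℕ) (x : ℝ) : ℝ :=
  ∑' k : ℕ, (1 / ((k.factorial : ℝ) * ((k + n).factorial : ℝ))) * x ^ k

lemma abs_inv_factorial_mul_le (n k : ℕ) :
    |1 / ((k.factorial : ℝ) * ((k + n).factorial : ℝ))| ≤ 1 / k.factorial := by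
  rw [abs_of_nonneg (by positivity)]
  have : (1 : ℝ) ≤ ((k + n).factorial : ℝ) := by exact_mod_cast Nat.factorial_pos _
  gcongr
  exact le_mul_of_one_le_right (by positivity) this

lemma besselI_eq (n : ℕ) (z : ℝ) :
    besselI n z = (z / 2) ^ n * besselSeries n ((z / 2) ^ 2) := by
  rw [besselI, besselSeries, ← tsum_mul_left]
  congr 1 with k
  rw [pow_add, pow_mul]
  ring

lemma hasDerivAt_besselSeries (n : ℕ) (x : ℝ) :
    HasDerivAt (besselSeries n) (besselSeries (n + 1) x) x := by
  convert! hasDerivAt_tsum_mul_pow (abs_inv_factorial_mul_le n) x using 1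
  rw [besselSeries]
  congr 1 with k
  rw [show k + 1 + n = k + (n + 1) by ring, Nat.factorial_succ k]
  push_cast
  field_simp

/-- Compare coefficients of each power of x. This is what yields I₁' = I₀ - I₁/z. -/
lemma besselSeries_recurrence (x : ℝ) :
    besselSeries 1 x + x * besselSeries 2 x = besselSeries 0 x := by
  have h1 := summable_of_abs_le_inv_factorial (abs_inv_factorial_mul_le 1) x
  have h2 := summable_of_abs_le_inv_factorial (abs_inv_factorial_mul_le 2) x
  have h0 := summable_of_abs_le_inv_factorial (abs_inv_factorial_mul_le 0) x
  rw [besselSeries, besselSeries, besselSeries, h0.tsum_eq_zero_add, h1.tsum_eq_zero_add,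
    ← tsum_mul_left, add_assoc, ← ((summable_nat_add_iff 1).2 h1).tsum_add (h2.mul_left x)]
  congr 1
  refine tsum_congr fun k => ?_
  simp only [add_zero, show k + 2 = k + 1 + 1 by ring, Nat.factorial_succ]
  push_cast
  field_simp
  ring

lemma hasDerivAt_besselI_zero (z : ℝ) : HasDerivAt (besselI 0) (besselI 1 z) z := by
  have h1 : HasDerivAt (fun z : ℝ => (z / 2) ^ 2) (z / 2) z := by
    convert! ((hasDerivAt_id z).div_const 2).pow 2 using 1
    simp
    ring
  have h2 := (hasDerivAt_besselSeries 0 ((z / 2) ^ 2)).comp z h1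
  rw [besselI_eq, show besselI 0 = fun z => besselSeries 0 ((z / 2) ^ 2) from
    funext fun z => by rw [besselI_eq, pow_zero, one_mul]]
  convert! h2 using 1
  ring

lemma hasDerivAt_besselI_one {z : ℝ} (hz : z ≠ 0) :
    HasDerivAt (besselI 1) (besselI 0 z - besselI 1 z / z) z := by
  have h1 : HasDerivAt (fun z : ℝ => (z / 2) ^ 2) (z / 2) z := by
    convert! ((hasDerivAt_id z).div_const 2).pow 2 using 1
    simp
    ring
  have h2 := ((hasDerivAt_id z).div_const 2).mul
    ((hasDerivAt_besselSeries 1 ((z / 2) ^ 2)).comp z h1)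
  rw [besselI_eq, besselI_eq, show besselI 1 = fun z => z / 2 * besselSeries 1 ((z / 2) ^ 2) from
    funext fun z => by rw [besselI_eq, pow_one]]
  convert! h2 using 1
  rw [← besselSeries_recurrence]
  simp only [Function.comp_apply, id]
  field_simp
  ring

lemma continuous_besselI_zero : Continuous (besselI 0) :=
  continuous_iff_continuousAt.2 fun z => (hasDerivAt_besselI_zero z).continuousAt

lemma continuous_besselI_one : Continuous (besselI 1) := by
  have h : Continuous (besselSeries 1) :=
    continuous_iff_continuousAt.2 fun z => (hasDerivAt_besselSeries 1 z).continuousAt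
  rw [show besselI 1 = fun z => z / 2 * besselSeries 1 ((z / 2) ^ 2) from
    funext fun z => by rw [besselI_eq, pow_one]]
  fun_prop

lemma besselI_zero_apply_zero : besselI 0 0 = 1 := by
  rw [besselI_eq, besselSeries, tsum_eq_single 0]
  · simp
  · intro k hk
    simp [hk]

lemma besselI_one_apply_zero : besselI 1 0 = 0 := by
  simp [besselI_eq]

/-! ### Half-circle means of w K₁ and w K₀ and their differential system. -/

lemma integrableOn_mul_comp_sin {f g : ℝ → ℝ} (hf : ContinuousOn f (Ici 0)) (hg : Continuous g)
    {y : ℝ} (hy : 0 ≤ y) : IntegrableOn (fun θ => g θ * f (2 * y * sin θ)) (Ioo 0 π) := by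
  refine IntegrableOn.mono_set (ContinuousOn.integrableOn_Icc ?_) Ioo_subset_Icc_self
  refine hg.continuousOn.mul (hf.comp (by fun_prop) fun θ hθ => ?_)
  have := sin_nonneg_of_mem_Icc hθ
  exact mem_Ici.2 (by positivity)

/-- `f'` may be singular at 0, as for w K₀(w), so only w f'(w) is assumed bounded. That suffices
because 2 sin θ f'(w) = w f'(w)/y when w = 2y sin θ. -/
lemma hasDerivAt_integral_mul_comp_sin {f f' g : ℝ → ℝ} (hf : ContinuousOn f (Ici 0))
    (hf' : ContinuousOn f' (Ioi 0)) (hd : ∀ w, 0 < w → HasDerivAt f (f' w) w)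
    (hb : ∀ w, 0 < w → |w * f' w| ≤ 1 + w) (hg : Continuous g) (hg1 : ∀ θ, |g θ| ≤ 1)
    {y : ℝ} (hy : 0 < y) :
    HasDerivAt (fun y => ∫ θ in Ioo 0 π, g θ * f (2 * y * sin θ))
      (∫ θ in Ioo 0 π, g θ * (2 * sin θ * f' (2 * y * sin θ))) y := by
  have hs : Ioo (y / 2) (2 * y) ∈ 𝓝 y := Ioo_mem_nhds (by linarith) (by linarith)
  refine (hasDerivAt_integral_of_dominated_loc_of_deriv_le (μ := volume.restrict (Ioo 0 π))
    (F := fun y θ => g θ * f (2 * y * sin θ))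
    (F' := fun y θ => g θ * (2 * sin θ * f' (2 * y * sin θ)))
    -- For y/2 < x < 2y one has w = 2x sin θ ≤ 4y, and the division is by x ≥ y/2.
    (bound := fun _ => (1 + 4 * y) / (y / 2)) hs ?_ (integrableOn_mul_comp_sin hf hg hy.le) ?_ ?_
    (integrable_const _) ?_).2
  · filter_upwards [hs] with x hx
    exact (integrableOn_mul_comp_sin hf hg (by linarith [hx.1])).aestronglyMeasurable
  · refine ContinuousOn.aestronglyMeasurable ?_ measurableSet_Ioo
    refine hg.continuousOn.mul (ContinuousOn.mul (by fun_prop)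
      (hf'.comp (by fun_prop) fun θ hθ => ?_))
    have := sin_pos_of_mem_Ioo hθ
    exact mem_Ioi.2 (by positivity)
  · refine (ae_restrict_iff' measurableSet_Ioo).2 (ae_of_all _ fun θ hθ x hx => ?_)
    have h0 := sin_pos_of_mem_Ioo hθ
    have hx0 : 0 < x := by linarith [hx.1]
    have h1 := hb (2 * x * sin θ) (by positivity)
    have h2 : 2 * x * sin θ ≤ 4 * y := by
      nlinarith [sin_le_one θ, hx.2]
    have h3 : 2 * sin θ * f' (2 * x * sin θ)
        = (2 * x * sin θ * f' (2 * x * sin θ)) / x := by field_simp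
    rw [norm_mul, h3, norm_div, norm_eq_abs, norm_eq_abs, norm_of_nonneg hx0.le,
      ← one_mul ((1 + 4 * y) / (y / 2))]
    gcongr
    · exact hg1 θ
    · exact h1.trans (by linarith)
    · exact hx.1.le
  · refine (ae_restrict_iff' measurableSet_Ioo).2 (ae_of_all _ fun θ hθ x hx => ?_)
    have h0 := sin_pos_of_mem_Ioo hθ
    have hx0 : 0 < x := by linarith [hx.1]
    have h1 : HasDerivAt (fun x : ℝ => 2 * x * sin θ) (2 * sin θ) x := by
      simpa using ((hasDerivAt_id x).const_mul 2).mul_const (sin θ)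
    have h2 := ((hd _ (by positivity : 0 < 2 * x * sin θ)).comp x h1).const_mul (g θ)
    convert! h2 using 1
    ring

/-- The mean of `w K_1(w)`, `w = 2 y sin θ`, over a half circle. -/
def meanKOne (y : ℝ) : ℝ := 1 / π * ∫ θ in Ioo 0 π, 1 * mulBesselKOne (2 * y * sin θ)

/-- The mean of `cos² θ w K_1(w)`, `w = 2 y sin θ`, over a half circle. -/
def meanCosSqKOne (y : ℝ) : ℝ :=
  1 / π * ∫ θ in Ioo 0 π, cos θ ^ 2 * mulBesselKOne (2 * y * sin θ)

/-- The mean of `sin θ w K_0(w)`, `w = 2 y sin θ`, over a half circle. -/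
def meanSinKZero (y : ℝ) : ℝ := 1 / π * ∫ θ in Ioo 0 π, sin θ * mulBesselKZero (2 * y * sin θ)

lemma abs_mean_le {f : ℝ → ℝ} (hf : ∀ θ ∈ Ioo 0 π, |f θ| ≤ 1) :
    |1 / π * ∫ θ in Ioo 0 π, f θ| ≤ 1 := by
  have h := norm_setIntegral_le_of_norm_le_const (μ := volume) (s := Ioo 0 π) (f := f)
    (C := 1) (by simp) hf
  rw [norm_eq_abs, volume_real_Ioo_of_le pi_pos.le, one_mul, sub_zero] at h
  rw [abs_mul, abs_of_pos (by positivity), one_div, inv_mul_le_iff₀ pi_pos, mul_one]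
  exact h

lemma abs_meanKOne_le {y : ℝ} (hy : 0 ≤ y) : |meanKOne y| ≤ 1 := by
  refine abs_mean_le fun θ hθ => ?_
  have := sin_pos_of_mem_Ioo hθ
  have hw : 0 ≤ 2 * y * sin θ := by positivity
  rw [one_mul, abs_of_nonneg (mulBesselKOne_nonneg hw)]
  exact mulBesselKOne_le_one hw

lemma abs_meanCosSqKOne_le {y : ℝ} (hy : 0 ≤ y) : |meanCosSqKOne y| ≤ 1 := by
  refine abs_mean_le fun θ hθ => ?_
  have := sin_pos_of_mem_Ioo hθ
  have hw : 0 ≤ 2 * y * sin θ := by positivity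
  rw [abs_of_nonneg (mul_nonneg (sq_nonneg _) (mulBesselKOne_nonneg hw))]
  exact mul_le_one₀ (cos_sq_le_one θ) (mulBesselKOne_nonneg hw) (mulBesselKOne_le_one hw)

lemma abs_meanSinKZero_le {y : ℝ} (hy : 0 ≤ y) : |meanSinKZero y| ≤ 1 := by
  refine abs_mean_le fun θ hθ => ?_
  have hs := sin_pos_of_mem_Ioo hθ
  have hw : 0 ≤ 2 * y * sin θ := by positivity
  rw [abs_of_nonneg (mul_nonneg hs.le (mulBesselKZero_nonneg hw))]
  exact mul_le_one₀ (sin_le_one θ) (mulBesselKZero_nonneg hw)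
    ((mulBesselKZero_le hw).trans (mulBesselKOne_le_one hw))

lemma exp_neg_le_meanKOne {y : ℝ} (hy : 0 ≤ y) : exp (-(2 * y)) ≤ meanKOne y := by
  have h : ∫ θ in Ioo 0 π, exp (-(2 * y)) ≤ ∫ θ in Ioo 0 π, 1 * mulBesselKOne (2 * y * sin θ) := by
    refine setIntegral_mono_on (integrable_const _)
      (integrableOn_mul_comp_sin continuousOn_mulBesselKOne continuous_const hy)
      measurableSet_Ioo fun θ hθ => ?_
    have hs := sin_pos_of_mem_Ioo hθ
    rw [one_mul]
    refine le_trans ?_ (exp_neg_le_mulBesselKOne (by positivity))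
    exact exp_le_exp.2 (by nlinarith [sin_le_one θ])
  rw [setIntegral_const, volume_real_Ioo_of_le pi_pos.le, sub_zero, smul_eq_mul] at h
  rw [meanKOne, one_div, le_inv_mul_iff₀ pi_pos]
  exact h

lemma hasDerivAt_meanKOne {y : ℝ} (hy : 0 < y) :
    HasDerivAt meanKOne (-2 * meanSinKZero y) y := by
  have h := (hasDerivAt_integral_mul_comp_sin (g := fun _ => 1) continuousOn_mulBesselKOne
    (f' := fun w => -mulBesselKZero w)
    (continuousOn_mulBesselKZero.neg.mono Ioi_subset_Ici_self)
    (fun w hw => hasDerivAt_mulBesselKOne hw) (fun w hw => ?_) continuous_const (by simp)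
    hy).const_mul (1 / π)
  · convert! h using 1
    rw [meanSinKZero, mul_left_comm, ← integral_const_mul]
    congr 2 with θ
    ring
  · rw [abs_mul, abs_neg, abs_of_pos hw, abs_of_nonneg (mulBesselKZero_nonneg hw.le)]
    nlinarith [mulBesselKZero_le hw.le, mulBesselKOne_le_one hw.le]

/-- Integrate the θ-derivative of sin θ cos θ · w K₁(w), which vanishes at both endpoints. This
closes the system, as the derivative of `meanCosSqKOne` then involves only the means themselves. -/
lemma integral_cos_sq_mul_sin_mul_mulBesselKZero {y : ℝ} (hy : 0 < y) :
    ∫ θ in Ioo 0 π, cos θ ^ 2 * (2 * sin θ * -mulBesselKZero (2 * y * sin θ)) =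
      1 / y * ((∫ θ in Ioo 0 π, 1 * mulBesselKOne (2 * y * sin θ)) -
        2 * ∫ θ in Ioo 0 π, cos θ ^ 2 * mulBesselKOne (2 * y * sin θ)) := by
  have hk : ContinuousOn (fun θ => mulBesselKOne (2 * y * sin θ)) (Icc 0 π) :=
    continuousOn_mulBesselKOne.comp (by fun_prop) fun θ hθ =>
      mem_Ici.2 (by have := sin_nonneg_of_mem_Icc hθ; positivity)
  have h1 := integrableOn_mul_comp_sin continuousOn_mulBesselKOne
    (continuous_const (y := (1 : ℝ))) hy.le
  have h2 := integrableOn_mul_comp_sin continuousOn_mulBesselKOne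
    (g := fun θ => cos θ ^ 2) (by fun_prop) hy.le
  have h3 := integrableOn_mul_comp_sin continuousOn_mulBesselKZero
    (g := fun θ => cos θ ^ 2 * (2 * sin θ) * -1) (by fun_prop) hy.le
  have h3' : IntegrableOn (fun θ => cos θ ^ 2 * (2 * sin θ * -mulBesselKZero (2 * y * sin θ)))
      (Ioo 0 π) := h3.congr_fun (fun θ _ => by ring) measurableSet_Ioo
  have hi := ((h2.const_mul 2).sub h1).add (h3'.const_mul y)
  have hftc := intervalIntegral.integral_eq_sub_of_hasDerivAt_of_le (a := 0) (b := π) pi_pos.le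
    (f := fun θ => sin θ * cos θ * mulBesselKOne (2 * y * sin θ))
    (f' := fun θ => 2 * (cos θ ^ 2 * mulBesselKOne (2 * y * sin θ))
      - 1 * mulBesselKOne (2 * y * sin θ)
      + y * (cos θ ^ 2 * (2 * sin θ * -mulBesselKZero (2 * y * sin θ))))
    (ContinuousOn.mul (by fun_prop) hk) (fun θ hθ => ?_) ?_
  · rw [intervalIntegral.integral_of_le pi_pos.le, integral_Ioc_eq_integral_Ioo,
      integral_add, integral_sub, integral_const_mul 2, integral_const_mul y] at hftc
    · simp only [sin_pi, sin_zero, zero_mul, sub_zero] at hftc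
      rw [one_div, eq_inv_mul_iff_mul_eq₀ hy.ne']
      linarith
    · exact h2.const_mul 2
    · exact h1
    · exact (h2.const_mul 2).sub h1
    · exact h3'.const_mul y
  · have hs := sin_pos_of_mem_Ioo hθ
    have hw : HasDerivAt (fun θ => 2 * y * sin θ) (2 * y * cos θ) θ :=
      (hasDerivAt_sin θ).const_mul _
    have := ((hasDerivAt_sin θ).mul (hasDerivAt_cos θ)).mul
      ((hasDerivAt_mulBesselKOne (by positivity : 0 < 2 * y * sin θ)).comp θ hw)
    convert! this using 1
    simp only [Function.comp_apply, Pi.mul_apply]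
    linear_combination mulBesselKOne (2 * y * sin θ) * sin_sq_add_cos_sq θ
  · rw [intervalIntegrable_iff_integrableOn_Ioo_of_le pi_pos.le]
    exact hi

lemma hasDerivAt_meanCosSqKOne {y : ℝ} (hy : 0 < y) :
    HasDerivAt meanCosSqKOne (meanKOne y / y - 2 * meanCosSqKOne y / y) y := by
  have h := (hasDerivAt_integral_mul_comp_sin (g := fun θ => cos θ ^ 2) continuousOn_mulBesselKOne
    (f' := fun w => -mulBesselKZero w)
    (continuousOn_mulBesselKZero.neg.mono Ioi_subset_Ici_self)
    (fun w hw => hasDerivAt_mulBesselKOne hw) (fun w hw => ?_) (by fun_prop)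
    (fun θ => by rw [abs_of_nonneg (sq_nonneg _)]; exact cos_sq_le_one θ) hy).const_mul (1 / π)
  · rw [integral_cos_sq_mul_sin_mul_mulBesselKZero hy] at h
    convert! h using 1
    rw [meanKOne, meanCosSqKOne]
    ring
  · rw [abs_mul, abs_neg, abs_of_pos hw, abs_of_nonneg (mulBesselKZero_nonneg hw.le)]
    nlinarith [mulBesselKZero_le hw.le, mulBesselKOne_le_one hw.le]

lemma hasDerivAt_meanSinKZero {y : ℝ} (hy : 0 < y) :
    HasDerivAt meanSinKZero (meanSinKZero y / y - 2 * meanKOne y + 2 * meanCosSqKOne y) y := by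
  have h := (hasDerivAt_integral_mul_comp_sin (g := sin) continuousOn_mulBesselKZero
    (f' := fun w => mulBesselKZero w / w - mulBesselKOne w)
    (((continuousOn_mulBesselKZero.mono Ioi_subset_Ici_self).div continuousOn_id
      fun w hw => (mem_Ioi.1 hw).ne').sub (continuousOn_mulBesselKOne.mono Ioi_subset_Ici_self))
    (fun w hw => hasDerivAt_mulBesselKZero hw) (fun w hw => ?_) continuous_sin
    abs_sin_le_one hy).const_mul (1 / π)
  · convert! h using 1
    have h1 := integrableOn_mul_comp_sin continuousOn_mulBesselKOne
      (continuous_const (y := (1 : ℝ))) hy.le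
    have h2 := integrableOn_mul_comp_sin continuousOn_mulBesselKOne
      (g := fun θ => cos θ ^ 2) (by fun_prop) hy.le
    have h3 := integrableOn_mul_comp_sin continuousOn_mulBesselKZero continuous_sin hy.le
    have e : ∫ θ in Ioo 0 π, sin θ * (2 * sin θ * (mulBesselKZero (2 * y * sin θ) /
          (2 * y * sin θ) - mulBesselKOne (2 * y * sin θ))) =
        ∫ θ in Ioo 0 π, (1 / y * (sin θ * mulBesselKZero (2 * y * sin θ))
          - 2 * (1 * mulBesselKOne (2 * y * sin θ))
          + 2 * (cos θ ^ 2 * mulBesselKOne (2 * y * sin θ))) := by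
      refine setIntegral_congr_fun measurableSet_Ioo fun θ hθ => ?_
      have hs := sin_pos_of_mem_Ioo hθ
      rw [cos_sq']
      field_simp
      ring
    rw [e, integral_add, integral_sub, integral_const_mul (1 / y), integral_const_mul 2,
      integral_const_mul 2,
      meanSinKZero, meanKOne, meanCosSqKOne]
    · ring
    · exact h3.const_mul _
    · exact h1.const_mul _
    · exact (h3.const_mul _).sub (h1.const_mul _)
    · exact h2.const_mul _
  · have e : w * (mulBesselKZero w / w - mulBesselKOne w)
        = mulBesselKZero w - w * mulBesselKOne w := by field_simp
    have h1 := mulBesselKZero_le hw.le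
    have h2 := mulBesselKOne_le_one hw.le
    have h3 := mulBesselKZero_nonneg hw.le
    rw [e, abs_le]
    constructor <;> nlinarith

/-! ### First integrals and the closed form of the means. -/

lemma eq_of_hasDerivAt_zero_of_tendsto {f : ℝ → ℝ} {c : ℝ} {l : Filter ℝ} [l.NeBot]
    (hl : ∀ᶠ y in l, 0 < y) (hd : ∀ y, 0 < y → HasDerivAt f 0 y) (hc : Tendsto f l (𝓝 c))
    {y : ℝ} (hy : 0 < y) : f y = c := by
  refine tendsto_nhds_unique (tendsto_const_nhds.congr' ?_) hc
  filter_upwards [hl] with x hx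
  exact isOpen_Ioi.is_const_of_deriv_eq_zero isPreconnected_Ioi
    (fun z hz => (hd z hz).differentiableAt.differentiableWithinAt)
    (fun z hz => (hd z hz).deriv) hy hx

lemma tendsto_mul_zero_of_abs_le_one {u v : ℝ → ℝ} {l : Filter ℝ} (hu : Tendsto u l (𝓝 0))
    (hv : ∀ᶠ x in l, |v x| ≤ 1) : Tendsto (fun x => u x * v x) l (𝓝 0) := by
  refine squeeze_zero_norm' ?_ (by simpa using hu.abs)
  filter_upwards [hv] with x hx
  rw [norm_mul, norm_eq_abs]
  exact mul_le_of_le_one_right (abs_nonneg _) hx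

lemma tendsto_id_zero_right : Tendsto (fun y : ℝ => y) (𝓝[>] 0) (𝓝 0) :=
  tendsto_id.mono_left nhdsWithin_le_nhds

lemma tendsto_besselI_zero_right : Tendsto (besselI 0) (𝓝[>] 0) (𝓝 1) := by
  have := continuous_besselI_zero.tendsto 0
  rw [besselI_zero_apply_zero] at this
  exact this.mono_left nhdsWithin_le_nhds

lemma tendsto_besselI_one_right : Tendsto (besselI 1) (𝓝[>] 0) (𝓝 0) := by
  have := continuous_besselI_one.tendsto 0
  rw [besselI_one_apply_zero] at this
  exact this.mono_left nhdsWithin_le_nhds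

lemma tendsto_mulBesselKZero_right : Tendsto mulBesselKZero (𝓝[>] 0) (𝓝 0) :=
  tendsto_mulBesselKZero_zero.mono_left (nhdsWithin_mono _ Ioi_subset_Ici_self)

lemma tendsto_mulBesselKOne_right : Tendsto mulBesselKOne (𝓝[>] 0) (𝓝 1) := by
  have := continuousOn_mulBesselKOne 0 self_mem_Ici
  rw [ContinuousWithinAt, mulBesselKOne_zero] at this
  exact this.mono_left (nhdsWithin_mono _ Ioi_subset_Ici_self)

lemma tendsto_meanKOne_right : Tendsto meanKOne (𝓝[>] 0) (𝓝 1) := by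
  have hl : Tendsto (fun y : ℝ => exp (-(2 * y))) (𝓝[>] 0) (𝓝 1) := by
    have : ContinuousAt (fun y : ℝ => exp (-(2 * y))) 0 := by fun_prop
    simpa using this.tendsto.mono_left nhdsWithin_le_nhds
  refine tendsto_of_tendsto_of_tendsto_of_le_of_le' hl tendsto_const_nhds ?_ ?_
  · filter_upwards [self_mem_nhdsWithin] with y hy using exp_neg_le_meanKOne (mem_Ioi.1 hy).le
  · filter_upwards [self_mem_nhdsWithin] with y hy
      using (le_abs_self _).trans (abs_meanKOne_le (mem_Ioi.1 hy).le)

lemma tendsto_mulBesselKOne_atTop : Tendsto mulBesselKOne atTop (𝓝 0) := by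
  have h : Tendsto (fun w : ℝ => exp (-w) * (1 + w)) atTop (𝓝 0) := by
    have := tendsto_exp_neg_atTop_nhds_zero.add (tendsto_pow_mul_exp_neg_atTop_nhds_zero 1)
    rw [add_zero] at this
    refine this.congr fun w => ?_
    ring
  refine squeeze_zero' ?_ ?_ h
  · filter_upwards [eventually_ge_atTop 0] with w hw using mulBesselKOne_nonneg hw
  · filter_upwards [eventually_ge_atTop 0] with w hw using mulBesselKOne_le_exp_mul hw

lemma tendsto_mulBesselKZero_atTop : Tendsto mulBesselKZero atTop (𝓝 0) := by
  refine squeeze_zero' ?_ ?_ tendsto_mulBesselKOne_atTop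
  · filter_upwards [eventually_ge_atTop 0] with w hw using mulBesselKZero_nonneg hw
  · filter_upwards [eventually_ge_atTop 0] with w hw using mulBesselKZero_le hw

lemma wronskian_besselI_mulBesselK {y : ℝ} (hy : 0 < y) :
    besselI 0 y * mulBesselKOne y + besselI 1 y * mulBesselKZero y = 1 := by
  refine eq_of_hasDerivAt_zero_of_tendsto (l := 𝓝[>] 0)
    (f := fun y => besselI 0 y * mulBesselKOne y + besselI 1 y * mulBesselKZero y)
    self_mem_nhdsWithin (fun y hy => ?_) ?_ hy
  · convert! ((hasDerivAt_besselI_zero y).mul (hasDerivAt_mulBesselKOne hy)).add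
      ((hasDerivAt_besselI_one hy.ne').mul (hasDerivAt_mulBesselKZero hy)) using 1
    field_simp
    ring
  · simpa using (tendsto_besselI_zero_right.mul tendsto_mulBesselKOne_right).add
      (tendsto_besselI_one_right.mul tendsto_mulBesselKZero_right)

/-- This is y·q(I₀, -I₁). The means stay bounded and every coefficient tends to 0 at the origin, so
the constant is 0. -/
lemma invariant_besselI_besselI {y : ℝ} (hy : 0 < y) :
    -(y * besselI 0 y * besselI 1 y * meanKOne y) + y ^ 2 * besselI 0 y ^ 2 * meanCosSqKOne y
      - y ^ 2 * besselI 1 y ^ 2 * meanCosSqKOne y - y * besselI 1 y ^ 2 * meanSinKZero y = 0 := by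
  refine eq_of_hasDerivAt_zero_of_tendsto (l := 𝓝[>] 0)
    (f := fun y => -(y * besselI 0 y * besselI 1 y * meanKOne y)
      + y ^ 2 * besselI 0 y ^ 2 * meanCosSqKOne y
      - y ^ 2 * besselI 1 y ^ 2 * meanCosSqKOne y - y * besselI 1 y ^ 2 * meanSinKZero y)
    self_mem_nhdsWithin (fun y hy => ?_) ?_ hy
  · have hi := hasDerivAt_id y
    have h0 := hasDerivAt_besselI_zero y
    have h1 := hasDerivAt_besselI_one hy.ne'
    convert! (((((hi.mul h0).mul h1).mul (hasDerivAt_meanKOne hy)).neg.add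
      (((hi.pow 2).mul (h0.pow 2)).mul (hasDerivAt_meanCosSqKOne hy))).sub
      (((hi.pow 2).mul (h1.pow 2)).mul (hasDerivAt_meanCosSqKOne hy))).sub
      ((hi.mul (h1.pow 2)).mul (hasDerivAt_meanSinKZero hy)) using 1
    simp only [Pi.mul_apply, Pi.pow_apply, id]
    field_simp
    ring
  · have hi := tendsto_id_zero_right
    have h0 := tendsto_besselI_zero_right
    have h1 := tendsto_besselI_one_right
    have hE : ∀ᶠ y in 𝓝[>] (0 : ℝ), |meanKOne y| ≤ 1 := by
      filter_upwards [self_mem_nhdsWithin] with y hy using abs_meanKOne_le (mem_Ioi.1 hy).le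
    have hB : ∀ᶠ y in 𝓝[>] (0 : ℝ), |meanCosSqKOne y| ≤ 1 := by
      filter_upwards [self_mem_nhdsWithin] with y hy using abs_meanCosSqKOne_le (mem_Ioi.1 hy).le
    have hL : ∀ᶠ y in 𝓝[>] (0 : ℝ), |meanSinKZero y| ≤ 1 := by
      filter_upwards [self_mem_nhdsWithin] with y hy using abs_meanSinKZero_le (mem_Ioi.1 hy).le
    have := (((tendsto_mul_zero_of_abs_le_one (by simpa using (hi.mul h0).mul h1) hE).neg.add
      (tendsto_mul_zero_of_abs_le_one (by simpa using (hi.pow 2).mul (h0.pow 2)) hB)).sub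
      (tendsto_mul_zero_of_abs_le_one (by simpa using (hi.pow 2).mul (h1.pow 2)) hB)).sub
      (tendsto_mul_zero_of_abs_le_one (by simpa using hi.mul (h1.pow 2)) hL)
    simpa using this

/-- This is y·q(K₀, K₁), written with yK₀ and yK₁. Their decay makes it vanish at infinity. -/
lemma invariant_besselK_besselK {y : ℝ} (hy : 0 < y) :
    mulBesselKZero y * mulBesselKOne y * (meanKOne y / y)
      + mulBesselKZero y ^ 2 * meanCosSqKOne y
      - mulBesselKOne y ^ 2 * meanCosSqKOne y - mulBesselKOne y ^ 2 * (meanSinKZero y / y) = 0 := by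
  refine eq_of_hasDerivAt_zero_of_tendsto (l := atTop)
    (f := fun y => mulBesselKZero y * mulBesselKOne y * (meanKOne y / y)
      + mulBesselKZero y ^ 2 * meanCosSqKOne y
      - mulBesselKOne y ^ 2 * meanCosSqKOne y - mulBesselKOne y ^ 2 * (meanSinKZero y / y))
    (eventually_gt_atTop 0) (fun y hy => ?_) ?_ hy
  · have hi := hasDerivAt_id y
    have h0 := hasDerivAt_mulBesselKZero hy
    have h1 := hasDerivAt_mulBesselKOne hy
    convert! ((((h0.mul h1).mul ((hasDerivAt_meanKOne hy).div hi hy.ne')).add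
      ((h0.pow 2).mul (hasDerivAt_meanCosSqKOne hy))).sub
      ((h1.pow 2).mul (hasDerivAt_meanCosSqKOne hy))).sub
      ((h1.pow 2).mul ((hasDerivAt_meanSinKZero hy).div hi hy.ne')) using 1
    simp only [Pi.mul_apply, Pi.pow_apply, Pi.div_apply, id]
    field_simp
    ring
  · have h0 := tendsto_mulBesselKZero_atTop
    have h1 := tendsto_mulBesselKOne_atTop
    have hd : ∀ x y : ℝ, 1 ≤ y → |x| ≤ 1 → |x / y| ≤ 1 := fun x y hy hx => by
      rw [abs_div, abs_of_pos (a := y) (by linarith), div_le_one (by linarith)]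
      exact hx.trans hy
    have hE : ∀ᶠ y in atTop, |meanKOne y / y| ≤ 1 := by
      filter_upwards [eventually_ge_atTop 1] with y hy
        using hd _ _ hy (abs_meanKOne_le (by linarith))
    have hB : ∀ᶠ y in atTop, |meanCosSqKOne y| ≤ 1 := by
      filter_upwards [eventually_ge_atTop 1] with y hy using abs_meanCosSqKOne_le (by linarith)
    have hL : ∀ᶠ y in atTop, |meanSinKZero y / y| ≤ 1 := by
      filter_upwards [eventually_ge_atTop 1] with y hy
        using hd _ _ hy (abs_meanSinKZero_le (by linarith))
    have := (((tendsto_mul_zero_of_abs_le_one (by simpa using h0.mul h1) hE).add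
      (tendsto_mul_zero_of_abs_le_one (by simpa using h0.pow 2) hB)).sub
      (tendsto_mul_zero_of_abs_le_one (by simpa using h1.pow 2) hB)).sub
      (tendsto_mul_zero_of_abs_le_one (by simpa using h1.pow 2) hL)
    simpa using this

/-- This is y times twice the polar form of q at (I₀, -I₁) and (K₀, K₁). At the origin only I₀ · yK₁
· E survives, with limit 1. -/
lemma invariant_besselI_besselK {y : ℝ} (hy : 0 < y) :
    (besselI 0 y * mulBesselKOne y - besselI 1 y * mulBesselKZero y) * meanKOne y
      + 2 * y * besselI 0 y * mulBesselKZero y * meanCosSqKOne y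
      + 2 * y * besselI 1 y * mulBesselKOne y * meanCosSqKOne y
      + 2 * besselI 1 y * mulBesselKOne y * meanSinKZero y = 1 := by
  refine eq_of_hasDerivAt_zero_of_tendsto (l := 𝓝[>] 0)
    (f := fun y => (besselI 0 y * mulBesselKOne y - besselI 1 y * mulBesselKZero y) * meanKOne y
      + 2 * y * besselI 0 y * mulBesselKZero y * meanCosSqKOne y
      + 2 * y * besselI 1 y * mulBesselKOne y * meanCosSqKOne y
      + 2 * besselI 1 y * mulBesselKOne y * meanSinKZero y)
    self_mem_nhdsWithin (fun y hy => ?_) ?_ hy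
  · have hi := (hasDerivAt_id y).const_mul 2
    have h0 := hasDerivAt_besselI_zero y
    have h1 := hasDerivAt_besselI_one hy.ne'
    have k0 := hasDerivAt_mulBesselKZero hy
    have k1 := hasDerivAt_mulBesselKOne hy
    convert! (((((h0.mul k1).sub (h1.mul k0)).mul (hasDerivAt_meanKOne hy)).add
      (((hi.mul h0).mul k0).mul (hasDerivAt_meanCosSqKOne hy))).add
      (((hi.mul h1).mul k1).mul (hasDerivAt_meanCosSqKOne hy))).add
      (((h1.const_mul 2).mul k1).mul (hasDerivAt_meanSinKZero hy)) using 1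
    simp only [Pi.mul_apply, Pi.sub_apply, id]
    field_simp
    ring
  · have hi := tendsto_id_zero_right.const_mul 2
    have h0 := tendsto_besselI_zero_right
    have h1 := tendsto_besselI_one_right
    have k0 := tendsto_mulBesselKZero_right
    have k1 := tendsto_mulBesselKOne_right
    have hB : ∀ᶠ y in 𝓝[>] (0 : ℝ), |meanCosSqKOne y| ≤ 1 := by
      filter_upwards [self_mem_nhdsWithin] with y hy using abs_meanCosSqKOne_le (mem_Ioi.1 hy).le
    have hL : ∀ᶠ y in 𝓝[>] (0 : ℝ), |meanSinKZero y| ≤ 1 := by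
      filter_upwards [self_mem_nhdsWithin] with y hy using abs_meanSinKZero_le (mem_Ioi.1 hy).le
    have := (((((h0.mul k1).sub (h1.mul k0)).mul tendsto_meanKOne_right).add
      (tendsto_mul_zero_of_abs_le_one (by simpa using (hi.mul h0).mul k0) hB)).add
      (tendsto_mul_zero_of_abs_le_one (by simpa using (hi.mul h1).mul k1) hB)).add
      (tendsto_mul_zero_of_abs_le_one (by simpa using (h1.const_mul 2).mul k1) hL)
    simpa using this

/-- Write k₀ = yK₀, k₁ = yK₁. By the Wronskian, (1, 0) = k₁(I₀, -I₁) + I₁(k₀, k₁) and (0, 1) =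
-k₀(I₀, -I₁) + I₀(k₀, k₁). Both basis vectors are isotropic for q, so q(1, 0) = P and q(0, 1) = -Q
reduce to the cross terms I₁k₁ and -I₀k₀. -/
lemma mul_meanCosSqKOne_and_add {y : ℝ} (hy : 0 < y) :
    y * meanCosSqKOne y = besselI 1 y * mulBesselKOne y ∧
      y * meanCosSqKOne y + meanSinKZero y = besselI 0 y * mulBesselKZero y := by
  have hW := wronskian_besselI_mulBesselK hy
  have hI : -(besselI 0 y * besselI 1 y * meanKOne y) + y * besselI 0 y ^ 2 * meanCosSqKOne y
      - besselI 1 y ^ 2 * (y * meanCosSqKOne y + meanSinKZero y) = 0 := by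
    refine mul_left_cancel₀ hy.ne' ?_
    linear_combination invariant_besselI_besselI hy
  have hK : mulBesselKZero y * mulBesselKOne y * meanKOne y
      + y * mulBesselKZero y ^ 2 * meanCosSqKOne y
      - mulBesselKOne y ^ 2 * (y * meanCosSqKOne y + meanSinKZero y) = 0 := by
    have h := invariant_besselK_besselK hy
    field_simp at h
    linear_combination h
  have hIK := invariant_besselI_besselK hy
  constructor
  · linear_combination mulBesselKOne y ^ 2 * hI + besselI 1 y ^ 2 * hK
      + mulBesselKOne y * besselI 1 y * hIK - y * meanCosSqKOne y *
        (besselI 0 y * mulBesselKOne y + besselI 1 y * mulBesselKZero y + 1) * hW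
  · linear_combination -mulBesselKZero y ^ 2 * hI - besselI 0 y ^ 2 * hK
      + mulBesselKZero y * besselI 0 y * hIK - (y * meanCosSqKOne y + meanSinKZero y) *
        (besselI 0 y * mulBesselKOne y + besselI 1 y * mulBesselKZero y + 1) * hW

/-- The half-circle mean of `cos² θ w K_1(w)`, `w = 2 y sin θ`, is `I_1(y) K_1(y)`. -/
theorem meanCosSqKOne_eq {y : ℝ} (hy : 0 < y) :
    meanCosSqKOne y = besselI 1 y * besselK 1 y := by
  have h := (mul_meanCosSqKOne_and_add hy).1
  rw [mulBesselKOne_of_pos hy] at h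
  refine mul_left_cancel₀ hy.ne' ?_
  linear_combination h

/-- The half-circle mean of `sin θ w K_0(w)`, `w = 2 y sin θ`, is
`y (I_0(y) K_0(y) - I_1(y) K_1(y))`. -/
theorem meanSinKZero_eq {y : ℝ} (hy : 0 < y) :
    meanSinKZero y = y * (besselI 0 y * besselK 0 y - besselI 1 y * besselK 1 y) := by
  have h := (mul_meanCosSqKOne_and_add hy).2
  rw [meanCosSqKOne_eq hy, mulBesselKZero] at h
  linear_combination h

/-! ### Integrals of the exponential profile along lines. -/

lemma integrableOn_pow_mul_exp_neg_div (n : ℕ) {d : ℝ} (hd : 0 < d) :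
    IntegrableOn (fun s : ℝ => s ^ n * exp (-s / d)) (Ioi 0) := by
  have h := integrableOn_rpow_mul_exp_neg_mul_rpow (p := 1) (s := n) (b := 1 / d)
    (by have : (0 : ℝ) ≤ n := n.cast_nonneg
        linarith) one_pos (by positivity)
  refine h.congr_fun (fun s _ => ?_) measurableSet_Ioi
  simp only [rpow_natCast, rpow_one]
  congr 2
  ring

lemma integrable_abs_pow_mul_exp_neg_abs_div (n : ℕ) {d : ℝ} (hd : 0 < d) :
    Integrable (fun s : ℝ => |s| ^ n * exp (-|s| / d)) := by
  have h := (integrable_fun_norm_addHaar (volume : Measure ℝ)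
    (f := fun s : ℝ => s ^ n * exp (-s / d))).2 (by
      simpa using integrableOn_pow_mul_exp_neg_div n hd)
  simpa using h

lemma integral_exp_neg_sqrt_div {b d : ℝ} (hb : 0 < b) (hd : 0 < d) :
    ∫ u : ℝ, exp (-√(u ^ 2 + b ^ 2) / d) = 2 * d * mulBesselKOne (b / d) := by
  have himg : (fun t => b * sinh t) '' univ = univ := by
    rw [image_univ]
    refine range_eq_univ.2 fun u => ?_
    obtain ⟨t, ht⟩ := sinh_surjective (u / b)
    exact ⟨t, by simp only [ht]; field_simp⟩
  have h := integral_image_eq_integral_abs_deriv_smul (s := univ) (f := fun t => b * sinh t)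
    (f' := fun t => b * cosh t) MeasurableSet.univ
    (fun t _ => ((hasDerivAt_sinh t).const_mul b).hasDerivWithinAt)
    (fun s _ t _ hst => sinh_injective (mul_left_cancel₀ hb.ne' hst))
    (fun u => exp (-√(u ^ 2 + b ^ 2) / d))
  rw [himg, setIntegral_univ, setIntegral_univ] at h
  rw [h]
  have e : ∀ t, |b * cosh t| • exp (-√((b * sinh t) ^ 2 + b ^ 2) / d)
      = b * (exp (-(b / d) * cosh |t|) * cosh |t| ^ 1) := fun t => by
    have h1 : (b * sinh t) ^ 2 + b ^ 2 = (b * cosh t) ^ 2 := by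
      rw [mul_pow, mul_pow, cosh_sq]; ring
    have h2 : 0 ≤ b * cosh t := mul_nonneg hb.le (cosh_pos t).le
    rw [h1, sqrt_sq h2, abs_of_nonneg h2, cosh_abs, smul_eq_mul,
      show -(b * cosh t) / d = -(b / d) * cosh t by ring]
    ring
  simp_rw [e]
  rw [integral_const_mul, integral_comp_abs (f := fun t => exp (-(b / d) * cosh t) * cosh t ^ 1),
    mulBesselKOne_of_pos (by positivity), besselK_one_eq, coshMoment]
  field_simp

/-- The distance to the origin of the point at polar coordinates `(s, θ)` about the point `(r, 0)`
of the plane. -/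
def shiftedRadius (r s θ : ℝ) : ℝ := √((s + r * cos θ) ^ 2 + (r * sin θ) ^ 2)

lemma norm_add_polar (r s θ : ℝ) :
    ‖(r : ℂ) + s * (cos θ + sin θ * Complex.I)‖ = shiftedRadius r s θ := by
  rw [Complex.norm_eq_sqrt_sq_add_sq, shiftedRadius]
  congr 1
  simp [-Complex.ofReal_cos, -Complex.ofReal_sin]
  linear_combination (s ^ 2 - r ^ 2) * sin_sq_add_cos_sq θ

lemma shiftedRadius_sub_pi (r s θ : ℝ) : shiftedRadius r s (θ - π) = shiftedRadius r (-s) θ := by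
  rw [shiftedRadius, shiftedRadius, cos_sub_pi, sin_sub_pi]
  congr 1
  ring

lemma continuous_shiftedRadius (r : ℝ) : Continuous fun p : ℝ × ℝ => shiftedRadius r p.1 p.2 := by
  unfold shiftedRadius
  fun_prop

lemma abs_sub_le_shiftedRadius {r : ℝ} (hr : 0 ≤ r) (s θ : ℝ) : |s| - r ≤ shiftedRadius r s θ := by
  have h1 : |s + r * cos θ| ≤ shiftedRadius r s θ := by
    rw [← sqrt_sq_eq_abs]
    exact sqrt_le_sqrt (by nlinarith [sq_nonneg (r * sin θ)])
  have h2 : |s| ≤ |s + r * cos θ| + |r * cos θ| := by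
    simpa using abs_sub (s + r * cos θ) (r * cos θ)
  have h3 : |r * cos θ| ≤ r := by
    rw [abs_mul, abs_of_nonneg hr]
    exact mul_le_of_le_one_right hr (abs_cos_le_one θ)
  linarith

lemma exp_neg_shiftedRadius_div_le {r d : ℝ} (hr : 0 ≤ r) (hd : 0 < d) (s θ : ℝ) :
    exp (-shiftedRadius r s θ / d) ≤ exp (r / d) * exp (-|s| / d) := by
  rw [← exp_add, ← add_div]
  have := abs_sub_le_shiftedRadius hr s θ
  exact exp_le_exp.2 (div_le_div_of_nonneg_right (by linarith) hd.le)

lemma integral_exp_neg_shiftedRadius {r d θ : ℝ} (hr : 0 < r) (hd : 0 < d) (hθ : θ ∈ Ioo 0 π) :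
    ∫ s, exp (-shiftedRadius r s θ / d) = 2 * d * mulBesselKOne (2 * (r / (2 * d)) * sin θ) := by
  have hs := sin_pos_of_mem_Ioo hθ
  rw [show 2 * (r / (2 * d)) * sin θ = r * sin θ / d by field_simp,
    ← integral_exp_neg_sqrt_div (by positivity) hd]
  exact integral_add_right_eq_self (fun u => exp (-√(u ^ 2 + (r * sin θ) ^ 2) / d)) (r * cos θ)

lemma integrable_mul_exp_neg_shiftedRadius {r d : ℝ} (hr : 0 ≤ r) (hd : 0 < d) (θ : ℝ) (n : ℕ) :
    Integrable fun s => s ^ n * exp (-shiftedRadius r s θ / d) := by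
  refine ((integrable_abs_pow_mul_exp_neg_abs_div n hd).const_mul (exp (r / d))).mono' ?_
    (ae_of_all _ fun s => ?_)
  · have := (continuous_shiftedRadius r).comp (Continuous.prodMk_left θ)
    exact ((continuous_pow n).mul (continuous_exp.comp (this.neg.div_const d))).aestronglyMeasurable
  · rw [norm_mul, norm_pow, norm_eq_abs, norm_of_nonneg (exp_pos _).le, mul_left_comm]
    gcongr
    exact exp_neg_shiftedRadius_div_le hr hd s θ

lemma integral_mul_exp_neg_shiftedRadius {r d θ : ℝ} (hr : 0 < r) (hd : 0 < d)
    (hθ : θ ∈ Ioo 0 π) :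
    ∫ s, s * exp (-shiftedRadius r s θ / d) =
      -(2 * d * r) * (cos θ * mulBesselKOne (2 * (r / (2 * d)) * sin θ)) := by
  have h0 := integrable_mul_exp_neg_shiftedRadius hr.le hd θ 0
  have h1 := integrable_mul_exp_neg_shiftedRadius hr.le hd θ 1
  simp only [pow_zero, one_mul, pow_one] at h0 h1
  -- s + r cos θ is the coordinate from the foot of the perpendicular dropped from the centre, and
  -- the profile is even in it.
  have hodd : ∫ s, (s + r * cos θ) * exp (-shiftedRadius r s θ / d) = 0 := by
    have e := integral_add_right_eq_self (μ := volume)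
      (fun u => u * exp (-√(u ^ 2 + (r * sin θ) ^ 2) / d)) (r * cos θ)
    have h := integral_neg_eq_self (fun u => u * exp (-√(u ^ 2 + (r * sin θ) ^ 2) / d)) volume
    simp only [neg_sq, neg_mul, integral_neg] at h
    refine e.trans ?_
    linarith
  simp only [add_mul] at hodd
  rw [integral_add h1 (h0.const_mul _), integral_const_mul,
    integral_exp_neg_shiftedRadius hr hd hθ] at hodd
  linarith

/-! ### Polar coordinates about the field point. -/

section Polar

variable {E : Type*} [NormedAddCommGroup E] [NormedSpace ℝ E]

/-- A polar integral is an integral over the lines through the origin. -/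
lemma setIntegral_polarCoord_target_eq {h : ℝ → ℝ → E} (hc : Continuous (Function.uncurry h))
    {C d : ℝ} {n : ℕ} (hd : 0 < d) (hb : ∀ s θ, ‖h s θ‖ ≤ C * (|s| ^ n * exp (-|s| / d)))
    (hper : ∀ s θ, h s (θ - π) = h (-s) θ) :
    ∫ p in polarCoord.target, h p.1 p.2 = ∫ θ in Ioo 0 π, ∫ s, h s θ := by
  have hdom := (integrable_abs_pow_mul_exp_neg_abs_div n hd).const_mul C
  have hint : Integrable (Function.uncurry h)
      ((volume.restrict (Ioi (0 : ℝ))).prod (volume.restrict (Ioo (-π) π))) :=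
    (hdom.restrict.comp_fst _).mono' hc.aestronglyMeasurable (ae_of_all _ fun p => hb p.1 p.2)
  have hline : ∀ θ, Integrable fun s => h s θ := fun θ =>
    hdom.mono' (hc.comp (Continuous.prodMk_left θ)).aestronglyMeasurable
      (ae_of_all _ fun s => hb s θ)
  set g : ℝ → E := fun θ => ∫ s in Ioi 0, h s θ with hg
  have hgi : IntervalIntegrable g volume (-π) π := by
    rw [intervalIntegrable_iff_integrableOn_Ioo_of_le (by linarith [pi_pos])]
    exact hint.integral_prod_right
  have hg1 : IntervalIntegrable g volume (-π) 0 :=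
    hgi.mono_set (uIcc_subset_uIcc left_mem_uIcc (mem_uIcc.2 (Or.inl ⟨by linarith [pi_pos],
      pi_pos.le⟩)))
  have hg2 : IntervalIntegrable g volume 0 π :=
    hgi.mono_set (uIcc_subset_uIcc (mem_uIcc.2 (Or.inl ⟨by linarith [pi_pos],
      pi_pos.le⟩)) right_mem_uIcc)
  have hg3 : IntervalIntegrable (fun θ => g (θ - π)) volume 0 π := by
    simpa using hg1.comp_sub_right π
  have e1 : ∫ p in polarCoord.target, h p.1 p.2 = ∫ θ in (-π)..π, g θ := by
    rw [polarCoord_target, Measure.volume_eq_prod, ← Measure.prod_restrict,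
      intervalIntegral.integral_of_le (by linarith [pi_pos]), integral_Ioc_eq_integral_Ioo]
    exact integral_prod_symm _ hint
  have e2 : ∫ θ in (0 : ℝ)..π, g (θ - π) = ∫ θ in (-π)..0, g θ := by
    rw [intervalIntegral.integral_comp_sub_right]; simp
  rw [e1, ← intervalIntegral.integral_add_adjacent_intervals hg1 hg2, ← e2,
    ← intervalIntegral.integral_add hg3 hg2, intervalIntegral.integral_of_le pi_pos.le,
    integral_Ioc_eq_integral_Ioo]
  -- The directions θ - π, with s replaced by -s, supply the negative half of the line at angle θ.
  congr 1 with θ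
  simp only [hg, hper]
  rw [integral_comp_neg_Ioi 0 (fun s => h s θ), neg_zero,
    intervalIntegral.integral_Iic_add_Ioi (hline θ).integrableOn (hline θ).integrableOn]

end Polar

lemma integral_exp_neg_norm_div_norm {r d : ℝ} (hr : 0 < r) (hd : 0 < d) :
    ∫ w : ℂ, exp (-‖(r : ℂ) + w‖ / d) * (1 / ‖w‖) = 2 * π * d * meanKOne (r / (2 * d)) := by
  have hcr := continuous_shiftedRadius r
  have h := setIntegral_polarCoord_target_eq (n := 0) (C := exp (r / d))
    (h := fun s θ => exp (-shiftedRadius r s θ / d))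
    (continuous_exp.comp (hcr.neg.div_const d)) hd
    (fun s θ => by
      rw [norm_of_nonneg (exp_pos _).le, pow_zero, one_mul]
      exact exp_neg_shiftedRadius_div_le hr.le hd s θ)
    (fun s θ => by rw [shiftedRadius_sub_pi])
  rw [← Complex.integral_comp_polarCoord_symm]
  have e : ∫ p in polarCoord.target, p.1 • (exp (-‖(r : ℂ) + Complex.polarCoord.symm p‖ / d) *
      (1 / ‖Complex.polarCoord.symm p‖)) =
      ∫ p in polarCoord.target, exp (-shiftedRadius r p.1 p.2 / d) := by
    refine setIntegral_congr_fun polarCoord.open_target.measurableSet fun p hp => ?_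
    have hp1 : 0 < p.1 := hp.1
    rw [Complex.norm_polarCoord_symm, Complex.polarCoord_symm_apply, norm_add_polar,
      abs_of_pos hp1, smul_eq_mul]
    field_simp
  rw [e, h, setIntegral_congr_fun measurableSet_Ioo
    fun θ hθ => integral_exp_neg_shiftedRadius hr hd hθ, integral_const_mul, meanKOne]
  simp only [one_mul]
  field_simp

/-- Odd under θ ↦ π - θ; this kills the azimuthal component of the force. -/
lemma integral_cos_mul_sin_mul_comp_sin (f : ℝ → ℝ) :
    ∫ θ in Ioo 0 π, cos θ * sin θ * f (sin θ) = 0 := by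
  rw [← integral_Ioc_eq_integral_Ioo, ← intervalIntegral.integral_of_le pi_pos.le]
  have h := intervalIntegral.integral_comp_sub_left (a := 0) (b := π)
    (fun θ => cos θ * sin θ * f (sin θ)) π
  simp only [cos_pi_sub, sin_pi_sub, neg_mul, intervalIntegral.integral_neg, sub_self,
    sub_zero] at h
  linarith

lemma integral_exp_neg_norm_smul_unit {E : Type*} [NormedAddCommGroup E] [NormedSpace ℝ E]
    [CompleteSpace E] (a b : E) {r d : ℝ} (hr : 0 < r) (hd : 0 < d) :
    ∫ w : ℂ, exp (-‖(r : ℂ) + w‖ / d) • (1 / ‖w‖) • (w.re • a + w.im • b) =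
      (-(2 * π * d * r) * meanCosSqKOne (r / (2 * d))) • a := by
  have hcr := continuous_shiftedRadius r
  have h := setIntegral_polarCoord_target_eq (n := 1) (C := exp (r / d) * (‖a‖ + ‖b‖))
    (h := fun s θ => (s * exp (-shiftedRadius r s θ / d)) • (cos θ • a + sin θ • b))
    (by
      refine (continuous_fst.mul (continuous_exp.comp (hcr.neg.div_const d))).smul ?_
      fun_prop) hd
    (fun s θ => by
      have h1 : ‖cos θ • a + sin θ • b‖ ≤ ‖a‖ + ‖b‖ := by
        refine (norm_add_le _ _).trans ?_
        rw [norm_smul, norm_smul]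
        exact add_le_add (mul_le_of_le_one_left (norm_nonneg a) (abs_cos_le_one θ))
          (mul_le_of_le_one_left (norm_nonneg b) (abs_sin_le_one θ))
      rw [norm_smul, norm_mul, norm_of_nonneg (exp_pos _).le, norm_eq_abs, pow_one]
      calc |s| * exp (-shiftedRadius r s θ / d) * ‖cos θ • a + sin θ • b‖
          ≤ |s| * (exp (r / d) * exp (-|s| / d)) * (‖a‖ + ‖b‖) := by
            gcongr
            exact exp_neg_shiftedRadius_div_le hr.le hd s θ
        _ = _ := by ring)
    (fun s θ => by
      simp only [shiftedRadius_sub_pi, cos_sub_pi, sin_sub_pi]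
      module)
  rw [← Complex.integral_comp_polarCoord_symm]
  have e : ∫ p in polarCoord.target, p.1 • (exp (-‖(r : ℂ) + Complex.polarCoord.symm p‖ / d) •
      (1 / ‖Complex.polarCoord.symm p‖) •
        ((Complex.polarCoord.symm p).re • a + (Complex.polarCoord.symm p).im • b)) =
      ∫ p in polarCoord.target, (p.1 * exp (-shiftedRadius r p.1 p.2 / d)) •
        (cos p.2 • a + sin p.2 • b) := by
    refine setIntegral_congr_fun polarCoord.open_target.measurableSet fun p hp => ?_
    have hp1 : 0 < p.1 := hp.1
    rw [Complex.norm_polarCoord_symm, Complex.polarCoord_symm_apply, norm_add_polar,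
      abs_of_pos hp1]
    have hre : ((p.1 : ℂ) * (cos p.2 + sin p.2 * Complex.I)).re = p.1 * cos p.2 := by
      simp [-Complex.ofReal_cos, -Complex.ofReal_sin]
    have him : ((p.1 : ℂ) * (cos p.2 + sin p.2 * Complex.I)).im = p.1 * sin p.2 := by
      simp [-Complex.ofReal_cos, -Complex.ofReal_sin]
    rw [hre, him, mul_smul p.1 (cos p.2), mul_smul p.1 (sin p.2), ← smul_add]
    simp only [smul_smul]
    congr 1
    field_simp
  have hk1 := integrableOn_mul_comp_sin continuousOn_mulBesselKOne
    (g := fun θ => cos θ ^ 2) (y := r / (2 * d)) (by fun_prop) (by positivity)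
  have hk2 := integrableOn_mul_comp_sin continuousOn_mulBesselKOne
    (g := fun θ => cos θ * sin θ) (y := r / (2 * d)) (by fun_prop) (by positivity)
  have e2 : ∫ θ in Ioo 0 π, ∫ s, (s * exp (-shiftedRadius r s θ / d)) • (cos θ • a + sin θ • b) =
      ∫ θ in Ioo 0 π, ((-(2 * d * r) *
          (cos θ ^ 2 * mulBesselKOne (2 * (r / (2 * d)) * sin θ))) • a +
        (-(2 * d * r) * (cos θ * sin θ * mulBesselKOne (2 * (r / (2 * d)) * sin θ))) • b) := by
    refine setIntegral_congr_fun measurableSet_Ioo fun θ hθ => ?_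
    rw [integral_smul_const, integral_mul_exp_neg_shiftedRadius hr hd hθ]
    module
  rw [e, h, e2, integral_add ((hk1.const_mul _).smul_const a) ((hk2.const_mul _).smul_const b),
    integral_smul_const, integral_smul_const, integral_const_mul, integral_const_mul,
    integral_cos_mul_sin_mul_comp_sin fun x => mulBesselKOne (2 * (r / (2 * d)) * x),
    mul_zero, zero_smul, add_zero, meanCosSqKOne]
  congr 1
  field_simp

/-! ### The disk measure: coordinates, mass and convergence. -/

lemma norm_planeEmbedding_sub (p q : EuclideanSpace ℝ (Fin 2)) :
    ‖planeEmbedding p - planeEmbedding q‖ = ‖p - q‖ := by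
  simp [EuclideanSpace.norm_eq, planeEmbedding, Fin.sum_univ_succ]

lemma norm_planeEmbedding (p : EuclideanSpace ℝ (Fin 2)) : ‖planeEmbedding p‖ = ‖p‖ := by
  simp [EuclideanSpace.norm_eq, planeEmbedding, Fin.sum_univ_succ]

lemma measurableEmbedding_planeEmbedding : MeasurableEmbedding planeEmbedding := by
  have h : Isometry planeEmbedding := Isometry.of_dist_eq fun p q => by
    rw [dist_eq_norm, dist_eq_norm, norm_planeEmbedding_sub]
  exact h.isClosedEmbedding.measurableEmbedding

/-- The orthogonal projection of space to the plane `z = 0`. -/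
def planeProj (x : Space) : EuclideanSpace ℝ (Fin 2) := !₂[x 0, x 1]

lemma norm_sub_planeProj_le (p : EuclideanSpace ℝ (Fin 2)) (x : Space) :
    ‖p - planeProj x‖ ≤ ‖planeEmbedding p - x‖ := by
  rw [EuclideanSpace.norm_eq, EuclideanSpace.norm_eq]
  refine sqrt_le_sqrt ?_
  simp only [planeEmbedding, planeProj, Fin.sum_univ_two, Fin.sum_univ_three]
  simp
  positivity

lemma continuous_planeEmbedding : Continuous planeEmbedding :=
  (Isometry.of_dist_eq fun p q => by
    rw [dist_eq_norm, dist_eq_norm, norm_planeEmbedding_sub]).continuous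

lemma measurable_surfaceDensity (S₀ Rd : ℝ) : Measurable
    fun p : EuclideanSpace ℝ (Fin 2) => ENNReal.ofReal (S₀ * exp (-‖p‖ / Rd)) := by
  fun_prop

section

variable {E : Type*} [NormedAddCommGroup E] [NormedSpace ℝ E] {S₀ : ℝ} (Rd : ℝ)

lemma integrable_disk_iff (hS₀ : 0 ≤ S₀) (f : Space → E) :
    Integrable f (disk S₀ Rd) ↔ Integrable fun p : EuclideanSpace ℝ (Fin 2) =>
      (S₀ * exp (-‖p‖ / Rd)) • f (planeEmbedding p) := by
  rw [disk, measurableEmbedding_planeEmbedding.integrable_map_iff,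
    integrable_withDensity_iff_integrable_smul' (measurable_surfaceDensity S₀ Rd)
      (ae_of_all _ fun _ => ENNReal.ofReal_lt_top)]
  refine integrable_congr (ae_of_all _ fun p => ?_)
  simp only [Function.comp_apply]
  rw [ENNReal.toReal_ofReal (by positivity)]

lemma integral_disk_eq (hS₀ : 0 ≤ S₀) (f : Space → E) :
    ∫ x, f x ∂disk S₀ Rd = ∫ p : EuclideanSpace ℝ (Fin 2),
      (S₀ * exp (-‖p‖ / Rd)) • f (planeEmbedding p) := by
  rw [disk, measurableEmbedding_planeEmbedding.integral_map,
    integral_withDensity_eq_integral_toReal_smul (measurable_surfaceDensity S₀ Rd)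
      (ae_of_all _ fun _ => ENNReal.ofReal_lt_top)]
  refine integral_congr_ae (ae_of_all _ fun p => ?_)
  simp only
  rw [ENNReal.toReal_ofReal (by positivity)]

/-- The horizontal azimuthal unit vector at azimuth `φ`. -/
def azimuthalDir (φ : ℝ) : Space := !₂[-sin φ, cos φ, 0]

/-- Integration against the disk in complex coordinates centred at the point `r e_r`. -/
lemma integral_disk_eq_integral_complex (hS₀ : 0 ≤ S₀) (f : Space → E) (r φ : ℝ) :
    ∫ x, f x ∂disk S₀ Rd = ∫ w : ℂ, (S₀ * exp (-‖(r : ℂ) + w‖ / Rd)) •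
      f (r • radialDir φ + (w.re • radialDir φ + w.im • azimuthalDir φ)) := by
  -- Rotation by φ, so that the real axis points along e_r.
  let T : ℂ ≃ₗᵢ[ℝ] EuclideanSpace ℝ (Fin 2) :=
    (rotation (Circle.exp φ)).trans Complex.orthonormalBasisOneI.repr
  have hT : ∀ w : ℂ, planeEmbedding (T (r + w)) =
      r • radialDir φ + (w.re • radialDir φ + w.im • azimuthalDir φ) := fun w => by
    have e : T (r + w) = Complex.orthonormalBasisOneI.repr (Circle.exp φ * (r + w)) := rfl
    ext i
    rw [e]
    fin_cases i <;>
      simp [planeEmbedding, radialDir, azimuthalDir, Complex.exp_ofReal_mul_I_re,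
        Complex.exp_ofReal_mul_I_im] <;> ring
  rw [integral_disk_eq Rd hS₀, ← T.measurePreserving.integral_comp
    T.toHomeomorph.measurableEmbedding, ← integral_add_left_eq_self _ (r : ℂ)]
  simp only [hT, T.norm_map]

end

lemma integrable_exp_neg_norm_mul_pow {d : ℝ} (hd : 0 < d) (n : ℕ) :
    Integrable fun p : EuclideanSpace ℝ (Fin 2) => ‖p‖ ^ n * exp (-‖p‖ / d) := by
  refine (integrable_fun_norm_addHaar volume (f := fun s : ℝ => s ^ n * exp (-s / d))).2 ?_
  refine (integrableOn_pow_mul_exp_neg_div (n + 1) hd).congr_fun (fun s _ => ?_) measurableSet_Ioi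
  simp [pow_succ]
  ring

lemma integrable_exp_neg_norm_div_norm {d : ℝ} (hd : 0 < d) :
    Integrable fun p : EuclideanSpace ℝ (Fin 2) => ‖p‖⁻¹ * exp (-‖p‖ / d) := by
  refine (integrable_fun_norm_addHaar volume (f := fun s : ℝ => s⁻¹ * exp (-s / d))).2 ?_
  refine (integrableOn_pow_mul_exp_neg_div 0 hd).congr_fun (fun s (hs : 0 < s) => ?_)
    measurableSet_Ioi
  simp
  field_simp

section

variable {S₀ Rd : ℝ}

lemma isFiniteMeasure_disk (S₀ : ℝ) (hRd : 0 < Rd) : IsFiniteMeasure (disk S₀ Rd) := by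
  have h := (integrable_exp_neg_norm_mul_pow hRd 0).const_mul S₀
  simp only [pow_zero, one_mul] at h
  have := isFiniteMeasure_withDensity_ofReal h.hasFiniteIntegral
  rw [disk]
  infer_instance

lemma totalMass_disk (hS₀ : 0 ≤ S₀) (hRd : 0 < Rd) :
    totalMass (disk S₀ Rd) = 2 * π * S₀ * Rd ^ 2 := by
  have h1 : totalMass (disk S₀ Rd) = ∫ _, (1 : ℝ) ∂disk S₀ Rd := by simp [totalMass]
  have h2 := integral_rpow_mul_exp_neg_mul_Ioi (a := 2) (r := 1 / Rd) (by norm_num) (by positivity)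
  have h3 : ∫ s in Ioi (0 : ℝ), s ^ (2 - 1) • exp (-s / Rd) = Rd ^ 2 := by
    have e : ∫ s in Ioi (0 : ℝ), s ^ (2 - 1) • exp (-s / Rd) =
        ∫ s in Ioi (0 : ℝ), s ^ ((2 : ℝ) - 1) * exp (-(1 / Rd * s)) := by
      refine setIntegral_congr_fun measurableSet_Ioi fun s _ => ?_
      norm_num
      left
      ring
    rw [e, h2]
    norm_num
  have h4 := integral_fun_norm_addHaar (volume : Measure (EuclideanSpace ℝ (Fin 2)))
    (fun s : ℝ => exp (-s / Rd))
  rw [finrank_euclideanSpace_fin, h3] at h4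
  rw [h1, integral_disk_eq Rd hS₀]
  simp only [smul_eq_mul, mul_one]
  rw [integral_const_mul, h4, measureReal_def, EuclideanSpace.volume_ball]
  simp [sq_sqrt pi_pos.le, one_add_one_eq_two, pi_pos.le]
  ring

lemma integrable_one_div_norm_sub_disk (hS₀ : 0 ≤ S₀) (hRd : 0 < Rd) (x : Space) :
    Integrable (fun x' => 1 / ‖x' - x‖) (disk S₀ Rd) := by
  rw [integrable_disk_iff Rd hS₀]
  set q := planeProj x with hq
  have hb := ((integrable_exp_neg_norm_div_norm hRd).comp_sub_right q).const_mul
    (S₀ * exp (‖q‖ / Rd))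
  refine hb.mono' ?_ ?_
  · have := continuous_planeEmbedding.measurable
    exact Measurable.aestronglyMeasurable (by fun_prop)
  · have hne : ∀ᵐ p : EuclideanSpace ℝ (Fin 2), p ≠ q := by
      simp [ae_iff]
    filter_upwards [hne] with p hp
    have h0 : 0 < ‖p - q‖ := norm_pos_iff.2 (sub_ne_zero.2 hp)
    have h1 := norm_sub_planeProj_le p x
    have h2 : exp (-‖p‖ / Rd) ≤ exp (‖q‖ / Rd) * exp (-‖p - q‖ / Rd) := by
      rw [← exp_add, ← add_div]
      refine exp_le_exp.2 (div_le_div_of_nonneg_right ?_ hRd.le)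
      linarith [norm_sub_le p q]
    rw [norm_smul, norm_of_nonneg (by positivity), norm_of_nonneg (by positivity)]
    calc S₀ * exp (-‖p‖ / Rd) * (1 / ‖planeEmbedding p - x‖)
        ≤ S₀ * (exp (‖q‖ / Rd) * exp (-‖p - q‖ / Rd)) * (1 / ‖p - q‖) := by gcongr
      _ = _ := by rw [one_div]; ring

lemma integrable_norm_sub_disk (hS₀ : 0 ≤ S₀) (hRd : 0 < Rd) (x : Space) :
    Integrable (fun x' => ‖x' - x‖) (disk S₀ Rd) := by
  have := isFiniteMeasure_disk S₀ hRd
  have h : Integrable (fun x' => ‖x'‖) (disk S₀ Rd) := by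
    rw [integrable_disk_iff Rd hS₀]
    refine ((integrable_exp_neg_norm_mul_pow hRd 1).const_mul S₀).congr (ae_of_all _ fun p => ?_)
    simp only [norm_planeEmbedding, pow_one, smul_eq_mul]
    ring
  refine (h.add (integrable_const ‖x‖)).mono' (by fun_prop) (ae_of_all _ fun x' => ?_)
  rw [norm_norm]
  exact norm_sub_le x' x

lemma integrable_unit_disk (S₀ : ℝ) (hRd : 0 < Rd) (x : Space) :
    Integrable (fun x' => (1 / ‖x' - x‖) • (x' - x)) (disk S₀ Rd) := by
  have := isFiniteMeasure_disk S₀ hRd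
  refine (integrable_const (1 : ℝ)).mono'
    (Measurable.aestronglyMeasurable (by fun_prop)) (ae_of_all _ fun x' => ?_)
  rw [norm_smul, norm_div, norm_one, norm_norm, one_div]
  exact inv_mul_le_one

/-! ### Force and potential in the disk plane. -/

lemma norm_radial_add_azimuthal (a b φ : ℝ) :
    ‖a • radialDir φ + b • azimuthalDir φ‖ = √(a ^ 2 + b ^ 2) := by
  rw [EuclideanSpace.norm_eq]
  congr 1
  simp [radialDir, azimuthalDir, Fin.sum_univ_three]
  linear_combination (a ^ 2 + b ^ 2) * sin_sq_add_cos_sq φ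

lemma norm_radialDir (φ : ℝ) : ‖radialDir φ‖ = 1 := by
  simpa using norm_radial_add_azimuthal 1 0 φ

lemma norm_re_im (w : ℂ) (φ : ℝ) :
    ‖w.re • radialDir φ + w.im • azimuthalDir φ‖ = ‖w‖ := by
  rw [norm_radial_add_azimuthal, Complex.norm_eq_sqrt_sq_add_sq]

lemma integral_one_div_norm_sub_disk (hS₀ : 0 ≤ S₀) (hRd : 0 < Rd) {r : ℝ} (hr : 0 < r) (φ : ℝ) :
    ∫ x', 1 / ‖x' - r • radialDir φ‖ ∂disk S₀ Rd =
      2 * π * S₀ * Rd * meanKOne (r / (2 * Rd)) := by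
  rw [integral_disk_eq_integral_complex Rd hS₀ _ r φ]
  simp only [add_sub_cancel_left, norm_re_im, smul_eq_mul, mul_assoc]
  rw [integral_const_mul, integral_exp_neg_norm_div_norm hr hRd]
  ring

lemma integral_unit_disk (hS₀ : 0 ≤ S₀) (hRd : 0 < Rd) {r : ℝ} (hr : 0 < r) (φ : ℝ) :
    ∫ x', (1 / ‖x' - r • radialDir φ‖) • (x' - r • radialDir φ) ∂disk S₀ Rd =
      (-(2 * π * S₀ * Rd * r) * meanCosSqKOne (r / (2 * Rd))) • radialDir φ := by
  rw [integral_disk_eq_integral_complex Rd hS₀ _ r φ]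
  simp only [add_sub_cancel_left, norm_re_im, mul_smul S₀]
  rw [integral_smul, integral_exp_neg_norm_smul_unit _ _ hr hRd, smul_smul]
  congr 1
  ring

lemma ae_disk_ne (x : Space) : ∀ᵐ x' ∂disk S₀ Rd, x' ≠ x := by
  rw [disk, measurableEmbedding_planeEmbedding.ae_map_iff]
  refine (withDensity_absolutelyContinuous _ _).ae_le ?_
  have h : ∀ᵐ p : EuclideanSpace ℝ (Fin 2), p ≠ planeProj x := by simp [ae_iff]
  filter_upwards [h] with p hp heq
  refine hp (norm_sub_eq_zero_iff.1 (le_antisymm ?_ (norm_nonneg _)))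
  simpa [heq] using norm_sub_planeProj_le p x

lemma hasDerivAt_norm_sub_smul {x e : Space} {r : ℝ} (hx : x ≠ r • e) :
    HasDerivAt (fun s : ℝ => ‖x - s • e‖)
      (-inner ℝ e ((1 / ‖x - r • e‖) • (x - r • e))) r := by
  have h0 : 0 < ‖x - r • e‖ := norm_pos_iff.2 (sub_ne_zero.2 hx)
  have h1 : HasDerivAt (fun s : ℝ => x - s • e) (-e) r := by
    simpa using ((hasDerivAt_id r).smul_const e).const_sub x
  have h2 := h1.norm_sq.sqrt (by positivity)
  simp only [sqrt_sq (norm_nonneg _)] at h2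
  convert! h2 using 1
  rw [inner_neg_right, real_inner_smul_right, real_inner_comm]
  field_simp

/-- The distance is 1-Lipschitz in s and differentiable off the field point, which is null for the
disk. Differentiating under the integral leaves the radial component of the unit-vector integral. -/
lemma hasDerivAt_integral_norm_sub_disk (hS₀ : 0 ≤ S₀) (hRd : 0 < Rd) {r : ℝ} (hr : 0 < r)
    (φ : ℝ) :
    HasDerivAt (fun s : ℝ => ∫ x', ‖x' - s • radialDir φ‖ ∂disk S₀ Rd)
      (2 * π * S₀ * Rd * r * meanCosSqKOne (r / (2 * Rd))) r := by
  have := isFiniteMeasure_disk S₀ hRd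
  have hi := integrable_unit_disk S₀ hRd (r • radialDir φ)
  have h := (hasDerivAt_integral_of_dominated_loc_of_lip (μ := disk S₀ Rd) (s := univ) (x₀ := r)
    (F := fun (s : ℝ) x' => ‖x' - s • radialDir φ‖)
    (F' := fun x' => -inner ℝ (radialDir φ)
      ((1 / ‖x' - r • radialDir φ‖) • (x' - r • radialDir φ))) (bound := fun _ => 1) univ_mem
    (Eventually.of_forall fun s => (integrable_norm_sub_disk hS₀ hRd (s • radialDir φ)).aestronglyMeasurable)
    (integrable_norm_sub_disk hS₀ hRd _) (hi.const_inner (𝕜 := ℝ) _).neg.aestronglyMeasurable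
    (ae_of_all _ fun x' => ?_) (integrable_const _) ?_).2
  · convert! h using 1
    rw [integral_neg, integral_inner hi, integral_unit_disk hS₀ hRd hr, real_inner_smul_right,
      real_inner_self_eq_norm_sq, norm_radialDir]
    ring
  · refine LipschitzOnWith.of_dist_le_mul fun s _ t _ => ?_
    rw [dist_eq_norm, dist_eq_norm]
    refine (abs_norm_sub_norm_le _ _).trans ?_
    rw [sub_sub_sub_cancel_left, ← sub_smul, norm_smul, norm_radialDir, norm_sub_rev]
    simp
  · filter_upwards [ae_disk_ne (S₀ := S₀) (Rd := Rd) (r • radialDir φ)] with x' hx'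
    exact hasDerivAt_norm_sub_smul hx'

lemma hasDerivAt_radialProfile_potential (G c₁ a₀ : ℝ) (hS₀ : 0 < S₀) (hRd : 0 < Rd) {r : ℝ}
    (hr : 0 < r) (φ : ℝ) :
    HasDerivAt (radialProfile (potential G c₁ a₀ (disk S₀ Rd)) φ)
      (2 * π * G * S₀ * meanSinKZero (r / (2 * Rd)) +
        2 * c₁ * a₀ / Rd * r * meanCosSqKOne (r / (2 * Rd))) r := by
  -- The closed form is differentiated here: the derivative of 1/|x' - x| has an inverse-square
  -- singularity, not absolutely integrable on the plane.
  have hP : HasDerivAt (fun s : ℝ => ∫ x', 1 / ‖x' - s • radialDir φ‖ ∂disk S₀ Rd)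
      (-(2 * π * S₀ * meanSinKZero (r / (2 * Rd)))) r := by
    have h1 : HasDerivAt (fun s : ℝ => s / (2 * Rd)) (1 / (2 * Rd)) r :=
      (hasDerivAt_id r).div_const _
    have h2 := ((hasDerivAt_meanKOne (by positivity : 0 < r / (2 * Rd))).comp r h1).const_mul
      (2 * π * S₀ * Rd)
    refine HasDerivAt.congr_of_eventuallyEq (f := fun s => 2 * π * S₀ * Rd *
      meanKOne (s / (2 * Rd))) ?_ ?_
    · convert! h2 using 1
      field_simp
    · filter_upwards [Ioi_mem_nhds hr] with s hs
        using integral_one_div_norm_sub_disk hS₀.le hRd hs φ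
  have h := (hP.const_mul (-G)).add
    ((hasDerivAt_integral_norm_sub_disk hS₀.le hRd hr φ).const_mul
      (2 * c₁ * a₀ / totalMass (disk S₀ Rd)))
  convert! h using 1
  rw [totalMass_disk hS₀.le hRd]
  have := pi_pos
  field_simp

end

end ExpDisk

end

theorem mainTheorem2 (G c₁ a₀ m S₀ Rd : ℝ) (hS₀ : 0 < S₀) (hRd : 0 < Rd) :
    -- the integrals that define the total mass, the potential and the force converge
    (IsFiniteMeasure (ExpDisk.disk S₀ Rd) ∧
      ∀ x : ExpDisk.Space,
        MeasureTheory.Integrable (fun x' => 1 / ‖x' - x‖) (ExpDisk.disk S₀ Rd) ∧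
        MeasureTheory.Integrable (fun x' => ‖x' - x‖) (ExpDisk.disk S₀ Rd) ∧
        MeasureTheory.Integrable (fun x' => (1 / ‖x' - x‖) • (x' - x)) (ExpDisk.disk S₀ Rd)) ∧
    ExpDisk.totalMass (ExpDisk.disk S₀ Rd) = 2 * Real.pi * S₀ * Rd ^ 2 ∧
    ∀ r φ y : ℝ, 0 < r → y = r / (2 * Rd) →
      DifferentiableAt ℝ
        (ExpDisk.radialProfile (ExpDisk.potential G c₁ a₀ (ExpDisk.disk S₀ Rd)) φ) r ∧
      ExpDisk.circularVelocitySq (ExpDisk.potential G c₁ a₀ (ExpDisk.disk S₀ Rd)) φ r =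
        4 * Real.pi * G * S₀ * Rd * y ^ 2 *
            (ExpDisk.besselI 0 y * ExpDisk.besselK 0 y -
              ExpDisk.besselI 1 y * ExpDisk.besselK 1 y) +
          8 * c₁ * a₀ * Rd * y ^ 2 * (ExpDisk.besselI 1 y * ExpDisk.besselK 1 y) ∧
      ExpDisk.accelForce c₁ a₀ m (ExpDisk.disk S₀ Rd) (r • ExpDisk.radialDir φ) =
        -(4 * c₁ * m * a₀ * y * (ExpDisk.besselI 1 y * ExpDisk.besselK 1 y)) •
          ExpDisk.radialDir φ := by
  refine ⟨⟨ExpDisk.isFiniteMeasure_disk S₀ hRd, fun x =>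
    ⟨ExpDisk.integrable_one_div_norm_sub_disk hS₀.le hRd x,
      ExpDisk.integrable_norm_sub_disk hS₀.le hRd x, ExpDisk.integrable_unit_disk S₀ hRd x⟩⟩,
    ExpDisk.totalMass_disk hS₀.le hRd, fun r φ y hr hy => ?_⟩
  have hy0 : 0 < y := by rw [hy]; positivity
  have hry : r = 2 * Rd * y := by rw [hy]; field_simp
  have h := ExpDisk.hasDerivAt_radialProfile_potential G c₁ a₀ hS₀ hRd hr φ
  rw [← hy, ExpDisk.meanSinKZero_eq hy0, ExpDisk.meanCosSqKOne_eq hy0] at h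
  refine ⟨h.differentiableAt, ?_, ?_⟩
  · rw [ExpDisk.circularVelocitySq, h.deriv, hry]
    field_simp
    ring
  · rw [ExpDisk.accelForce, ExpDisk.integral_unit_disk hS₀.le hRd hr, ← hy,
      ExpDisk.meanCosSqKOne_eq hy0, smul_smul, ExpDisk.totalMass_disk hS₀.le hRd]
    congr 1
    have := Real.pi_pos
    rw [hry]
    field_simp
    ring
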